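/- Consider the control-affine system $$\dot x(t)=g(x(t),u(t),w(t)):=f(x(t),w(t))+G(x(t))u(t),$$ with $f:\mathbb R^{n_x}\times\mathbb R^{n_w}\to\mathbb R^{n_x}$ and $G:\mathbb R^{n_x}\to\mathbb R^{n_x\times n_u}$ twice continuously differentiable, control set $U\subseteq\mathbb R^{n_u}$ and disturbance set $W\subseteq\mathbb R^{n_w}$. For $q\in\mathbb R^n$ and a symmetric positive semidefinite $Q\in\mathbb S^n_+$ let $\mathcal E(q,Q)=\{q+Q^{1/2}v : v^\top v\le 1\}$ and $\mathcal E(Q)=\mathcal E(0,Q)$; $A\succeq B$ means that $A-B$ is symmetric positive semidefinite. **Robust forward invariant tube (RFIT).** A set-valued function $Y$ on $[t_1,t_2]$ with values in the subsets of $\mathbb R^{n_x}$ is an RFIT if there is a feedback law $\mu:[t_1,t_2]\times\mathbb R^{n_x}\to U$, jointly Borel measurable and integrable in $t$ for each fixed state, such that for every integrable disturbance $w:[t_1,t_2]\to W$, all $s\le s'$ in $[t_1,t_2]$ and every absolutely continuous $x$ on $[s,s']$ satisfying $\dot x(t)=f(x(t),w(t))+G(x(t))\mu(t,x(t))$ for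 a.e. $t\in[s,s']$: if $x(s)\in Y(s)$ then $x(s')\in Y(s')$. **Assumptions.** 1. $q_w\in\mathbb R^{n_w}$, $Q_w\in\mathbb S^{n_w}_+$, $q_u\in\mathbb R^{n_u}$, $Q_u\in\mathbb S^{n_u}_+$ satisfy $W\subseteq\mathcal E(q_w,Q_w)$ and $\mathcal E(q_u,Q_u)\subseteq U$. 2. The reference control $u_x:[t_1,t_2]\to U$ is integrable with $u_x(t)\in\mathcal E(q_u,Q_u)$ for all $t$. For some $\gamma:[t_1,t_2]\to(0,1]$, $$R_u(t)=[1-\gamma(t)]\,Q_u+[1-\gamma(t)^{-1}]\,[u_x(t)-q_u][u_x(t)-q_u]^\top\succeq 0\qquad(t\in[t_1,t_2]).$$ 3. $q_x:[t_1,t_2]\to\mathbb R^{n_x}$ and $Q_x:[t_1,t_2]\to\mathbb S^{n_x}_+$ are absolutely continuous. Put $$A(t)=\tfrac{\partial f}{\partial x}(q_x(t),q_w)+\tfrac{\partial G}{\partial x}(q_x(t))\,u_x(t),\qquad B(t)=\tfrac{\partial f}{\partial w}(q_x(t),q_w).$$ 4. Let the nominal control $\bar u$, from which control perturbations are measured,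 be either $\bar u=u_x$ or $\bar u\equiv q_u$, and put $$n(t,\xi,\omega,\nu)=g(q_x(t)+\xi,\ \bar u(t)+\nu,\ q_w+\omega)-g(q_x(t),u_x(t),q_w)-A(t)\xi-B(t)\omega-G(q_x(t)+\xi)\nu .$$ The function $\Omega_n:\mathbb R^{n_x}\times\mathbb S^{n_x}_+\to\mathbb S^{n_x}_+$ satisfies $n(t,\xi,\omega,\nu)\in\mathcal E(\Omega_n(q_x(t),Q_x(t)))$ for all $t\in[t_1,t_2]$, $\xi\in\mathcal E(Q_x(t))$, $\omega\in\mathcal E(Q_w)$, $\nu\in\mathcal E(Q_u)$. 5. Put $H(t,S_0,M)=Q_x(t)^{1/2}S_0R_u(t)^{1/2}M^\top+M R_u(t)^{1/2}S_0^\top Q_x(t)^{1/2}$ for $S_0,M\in\mathbb R^{n_x\times n_u}$. The function $\Omega_G:\mathbb R^{n_x}\times\mathbb S^{n_x}_+\times\mathbb S^{n_u}_+\times\mathbb R^{n_x\times n_u}\to\mathbb S^{n_x}_+$ satisfies $$\Omega_G(q_x(t),Q_x(t),R_u(t),S_0)\succeq H(t,S_0,G(\xi))-H(t,S_0,G(q_x(t)))$$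 for all $t\in[t_1,t_2]$, all $\xi\in\mathcal E(q_x(t),Q_x(t))$ and all $S_0$ with $S_0S_0^\top\preceq I$. **Theorem.** Suppose that for some functions $\lambda,\kappa:[t_1,t_2]\to(0,\infty)$ and $S:[t_1,t_2]\to\mathbb R^{n_x\times n_u}$ with $S(t)S(t)^\top\preceq I$, the following hold for a.e. $t\in[t_1,t_2]$ (arguments $t$ omitted): $$\dot q_x=f(q_x,q_w)+G(q_x)u_x,$$ $$\dot Q_x\succeq AQ_x+Q_xA^\top+Q_x^{1/2}SR_u^{1/2}G(q_x)^\top+G(q_x)R_u^{1/2}S^\top Q_x^{1/2}+\Big(\frac1\lambda+\frac1\kappa\Big)Q_x+\Omega_G(q_x,Q_x,R_u,S)+\lambda\,BQ_wB^\top+\kappa\,\Omega_n(q_x,Q_x).$$ Then $Y(t)=\mathcal E(q_x(t),Q_x(t))$ is an RFIT for the system on $[t_1,t_2]$. -/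

import Mathlib

open MeasureTheory Set
open scoped Matrix

namespace EllTube

noncomputable section

/-- `ℝⁿ` with the Euclidean norm. -/
abbrev Vec (n : ℕ) : Type := EuclideanSpace ℝ (Fin n)

/-- Real `m × n` matrices. -/
abbrev Mat (m n : ℕ) : Type := Matrix (Fin m) (Fin n) ℝ

/-- The matrix-vector product on Euclidean spaces. -/
def act {m n : ℕ} (M : Mat m n) (v : Vec n) : Vec m := Matrix.toEuclideanLin M v

open scoped MatrixOrder in
/-- The symmetric positive semidefinite square root of a positive semidefinite matrix. -/
def msqrt {n : ℕ} (Q : Mat n n) : Mat n n := CFC.sqrt Q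

/-- The Loewner order `A ⪯ B`: the difference `B - A` is symmetric positive semidefinite. -/
def Loewner {n : ℕ} (A B : Mat n n) : Prop := (B - A).PosSemidef

/-- The ellipsoid `{q + Q^{1/2} v : vᵀ v ≤ 1}`. -/
def ellipsoid {n : ℕ} (q : Vec n) (Q : Mat n n) : Set (Vec n) :=
  {y | ∃ v : Vec n, ‖v‖ ≤ 1 ∧ y = q + act (msqrt Q) v}

/-- The Jacobian matrix of `F` at `x`. -/
def jacobian {m n : ℕ} (F : Vec n → Vec m) (x : Vec n) : Mat m n :=
  Matrix.of fun i j => (fderiv ℝ F x (EuclideanSpace.single j 1)) i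

/-- The entrywise time derivative of a matrix-valued function. -/
def matDeriv {m n : ℕ} (Q : ℝ → Mat m n) (t : ℝ) : Mat m n :=
  Matrix.of fun i j => deriv (fun s => Q s i j) t

/-- Signals on `[t₁, t₂]`: Lebesgue-integrable functions with values in `Z`. -/
def IsSignal {n : ℕ} (t₁ t₂ : ℝ) (Z : Set (Vec n)) (u : ℝ → Vec n) : Prop :=
  IntegrableOn u (Icc t₁ t₂) ∧ ∀ t ∈ Icc t₁ t₂, u t ∈ Z

section System

variable {nx nu nw : ℕ}

/-- The right-hand side `g(x, u, w) = f(x, w) + G(x) u` of the control system. -/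
def rhs (f : Vec nx → Vec nw → Vec nx) (G : Vec nx → Mat nx nu)
    (x : Vec nx) (u : Vec nu) (w : Vec nw) : Vec nx :=
  f x w + act (G x) u

/-- `x` is a (Carathéodory) solution on `[s, s']` of the closed-loop system
`ẋ(t) = f(x(t), w(t)) + G(x(t)) μ(t, x(t))`. -/
def IsClosedLoopSolution (f : Vec nx → Vec nw → Vec nx) (G : Vec nx → Mat nx nu)
    (μ : ℝ → Vec nx → Vec nu) (w : ℝ → Vec nw) (s s' : ℝ) (x : ℝ → Vec nx) : Prop :=
  AbsolutelyContinuousOnInterval x s s' ∧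
    ∀ᵐ t : ℝ, t ∈ Icc s s' → HasDerivAt x (rhs f G (x t) (μ t (x t)) (w t)) t

/-- `μ` is an integrable feedback law on `[t₁, t₂]` with values in `U`: jointly Borel measurable,
and integrable in time for every fixed state. -/
def IsFeedback (U : Set (Vec nu)) (t₁ t₂ : ℝ) (μ : ℝ → Vec nx → Vec nu) : Prop :=
  Measurable (Function.uncurry μ) ∧
    (∀ ξ, IntegrableOn (fun t => μ t ξ) (Icc t₁ t₂)) ∧
    ∀ t ∈ Icc t₁ t₂, ∀ ξ, μ t ξ ∈ U

/-- `Y` is a robust forward invariant tube on `[t₁, t₂]`: one feedback law, independent of the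
disturbance, keeps every closed-loop solution that is in `Y` at some time `s` inside `Y` at all
later times `s'`, whatever the disturbance. -/
def IsRFIT (f : Vec nx → Vec nw → Vec nx) (G : Vec nx → Mat nx nu)
    (U : Set (Vec nu)) (W : Set (Vec nw)) (t₁ t₂ : ℝ) (Y : ℝ → Set (Vec nx)) : Prop :=
  ∃ μ : ℝ → Vec nx → Vec nu, IsFeedback U t₁ t₂ μ ∧
    ∀ w : ℝ → Vec nw, IsSignal t₁ t₂ W w →
      ∀ s ∈ Icc t₁ t₂, ∀ s' ∈ Icc t₁ t₂, s ≤ s' →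
        ∀ x : ℝ → Vec nx, IsClosedLoopSolution f G μ w s s' x → x s ∈ Y s → x s' ∈ Y s'

/-- `A = ∂f/∂x (q, q_w) + ∂G/∂x (q) u`. -/
def Amat (f : Vec nx → Vec nw → Vec nx) (G : Vec nx → Mat nx nu) (qw : Vec nw)
    (q : Vec nx) (u : Vec nu) : Mat nx nx :=
  jacobian (fun x => f x qw) q + jacobian (fun x => act (G x) u) q

/-- `B = ∂f/∂w (q, q_w)`. -/
def Bmat (f : Vec nx → Vec nw → Vec nx) (qw : Vec nw) (q : Vec nx) : Mat nx nw :=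
  jacobian (fun w => f q w) qw

/-- The nonlinear remainder `n(ξ, ω, ν)` at a time at which the nominal state is `q`, the reference
control is `u` and control perturbations are measured from `ubar`. It is what makes
`δ̇ = A δ + B ω + G(q + δ) ν + n(δ, ω, ν)` equivalent to `ẋ = f(x, w) + G(x) u'`, for `x = q + δ`,
`w = q_w + ω`, `u' = ubar + ν`, and `q̇ = f(q, q_w) + G(q) u`. -/
def remainder (f : Vec nx → Vec nw → Vec nx) (G : Vec nx → Mat nx nu) (qw : Vec nw)
    (q : Vec nx) (u ubar : Vec nu) (ξ : Vec nx) (ω : Vec nw) (ν : Vec nu) : Vec nx :=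
  (rhs f G (q + ξ) (ubar + ν) (qw + ω) - rhs f G q u qw)
    - (act (Amat f G qw q u) ξ + act (Bmat f qw q) ω + act (G (q + ξ)) ν)

/-- The shape matrix `(1 - γ) Q_u + (1 - γ⁻¹) (u - q_u) (u - q_u)ᵀ`. -/
def innerShape (qu : Vec nu) (Qu : Mat nu nu) (γ : ℝ) (u : Vec nu) : Mat nu nu :=
  (1 - γ) • Qu + (1 - γ⁻¹) • Matrix.vecMulVec (u - qu).ofLp (u - qu).ofLp

/-- `Q^{1/2} S R^{1/2} G₀ᵀ + G₀ R^{1/2} Sᵀ Q^{1/2}`. -/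
def controlTerm (Q : Mat nx nx) (S : Mat nx nu) (R : Mat nu nu) (G₀ : Mat nx nu) : Mat nx nx :=
  msqrt Q * S * msqrt R * G₀ᵀ + G₀ * msqrt R * Sᵀ * msqrt Q

/-- The right-hand side `Φ_g` of the matrix differential inequality; `A` is evaluated along the
reference control `u`. -/
def Phi (f : Vec nx → Vec nw → Vec nx) (G : Vec nx → Mat nx nu) (qw : Vec nw) (Qw : Mat nw nw)
    (Ωn : Vec nx → Mat nx nx → Mat nx nx)
    (ΩG : Vec nx → Mat nx nx → Mat nu nu → Mat nx nu → Mat nx nx)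
    (u : Vec nu) (q : Vec nx) (Q : Mat nx nx) (S : Mat nx nu) (R : Mat nu nu) (lam kap : ℝ) :
    Mat nx nx :=
  Amat f G qw q u * Q + Q * (Amat f G qw q u)ᵀ + controlTerm Q S R (G q)
    + (1 / lam + 1 / kap) • Q + ΩG q Q R S
    + lam • (Bmat f qw q * Qw * (Bmat f qw q)ᵀ) + kap • Ωn q Q

/-- `Ωn` is a nonlinearity bounder for the remainder along the tube. -/
def IsRemainderBounder (f : Vec nx → Vec nw → Vec nx) (G : Vec nx → Mat nx nu)
    (qw : Vec nw) (Qw : Mat nw nw) (Qu : Mat nu nu) (t₁ t₂ : ℝ) (ux ubar : ℝ → Vec nu)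
    (qx : ℝ → Vec nx) (Qx : ℝ → Mat nx nx) (Ωn : Vec nx → Mat nx nx → Mat nx nx) : Prop :=
  (∀ q Q, Q.PosSemidef → (Ωn q Q).PosSemidef) ∧
    ∀ t ∈ Icc t₁ t₂, ∀ ξ ∈ ellipsoid 0 (Qx t), ∀ ω ∈ ellipsoid 0 Qw, ∀ ν ∈ ellipsoid 0 Qu,
      remainder f G qw (qx t) (ux t) (ubar t) ξ ω ν ∈ ellipsoid 0 (Ωn (qx t) (Qx t))

/-- `ΩG` is a nonlinearity bounder for the input matrix `G` along the tube. -/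
def IsInputBounder (G : Vec nx → Mat nx nu) (t₁ t₂ : ℝ) (qx : ℝ → Vec nx) (Qx : ℝ → Mat nx nx)
    (Ru : ℝ → Mat nu nu) (ΩG : Vec nx → Mat nx nx → Mat nu nu → Mat nx nu → Mat nx nx) : Prop :=
  (∀ q Q R S, Q.PosSemidef → R.PosSemidef → (ΩG q Q R S).PosSemidef) ∧
    ∀ t ∈ Icc t₁ t₂, ∀ ξ ∈ ellipsoid (qx t) (Qx t), ∀ S₀ : Mat nx nu, Loewner (S₀ * S₀ᵀ) 1 →
      Loewner (controlTerm (Qx t) S₀ (Ru t) (G ξ) - controlTerm (Qx t) S₀ (Ru t) (G (qx t)))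
        (ΩG (qx t) (Qx t) (Ru t) S₀)

end System

end

end EllTube

/-!
The matrix inequality says that every point `q + Q z` of the tube has a control, the nominal one
plus a gain applied to `z`, whose velocity is tangent to the moving ellipsoid for every
disturbance: on the boundary the terms with `1 / λ` and `1 / κ` pay for the disturbance and for
the nonlinearity by the inequality of arithmetic and geometric means, and on the kernel of `Q` all
terms of the inequality vanish, so that the velocity satisfies a range condition which replaces
the invertibility of `Q`. The feedback law uses, at a state `ξ`, a measurably selected control
that is viable at the point of the tube nearest to `ξ`. The distance `D` of a closed loop solution
to the tube then satisfies `D' ≤ L * D` almost everywhere. Since `D` is also one-sided Lipschitz,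
no upward jump or singular growth can occur, and Grönwall's inequality gives `D = 0`.
-/

namespace EllTube

noncomputable section

section Act

variable {l m n : ℕ}

lemma act_apply (M : Mat m n) (v : Vec n) (i : Fin m) : act M v i = ∑ j, M i j * v j := rfl

@[simp] lemma act_add (M : Mat m n) (v w : Vec n) : act M (v + w) = act M v + act M w :=
  map_add _ _ _

@[simp] lemma act_sub (M : Mat m n) (v w : Vec n) : act M (v - w) = act M v - act M w :=
  map_sub _ _ _

@[simp] lemma act_smul (M : Mat m n) (a : ℝ) (v : Vec n) : act M (a • v) = a • act M v :=
  map_smul _ _ _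

@[simp] lemma act_zero (M : Mat m n) : act M (0 : Vec n) = 0 := map_zero _

@[simp] lemma act_neg (M : Mat m n) (v : Vec n) : act M (-v) = -act M v := map_neg _ _

@[simp] lemma add_act (M N : Mat m n) (v : Vec n) : act (M + N) v = act M v + act N v := by
  simp [act]

@[simp] lemma sub_act (M N : Mat m n) (v : Vec n) : act (M - N) v = act M v - act N v := by
  simp [act]

@[simp] lemma smul_act (a : ℝ) (M : Mat m n) (v : Vec n) : act (a • M) v = a • act M v := by
  simp [act]

@[simp] lemma one_act (v : Vec n) : act (1 : Mat n n) v = v := by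
  simp [act]

lemma mul_act (M : Mat l m) (N : Mat m n) (v : Vec n) : act (M * N) v = act M (act N v) := by
  simp [act, Matrix.toLpLin_apply]

lemma inner_act (M : Mat m n) (x : Vec m) (v : Vec n) :
    inner ℝ x (act M v) = inner ℝ (act Mᵀ x) v := by
  simp only [PiLp.inner_apply, act_apply, RCLike.inner_apply, conj_trivial, Matrix.transpose_apply,
    Finset.sum_mul, Finset.mul_sum]
  rw [Finset.sum_comm]
  exact Finset.sum_congr rfl fun i _ => Finset.sum_congr rfl fun j _ => by ring

lemma inner_vecMulVec_act (a c : Vec n) :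
    inner ℝ c (act (Matrix.vecMulVec a.ofLp a.ofLp) c) = (inner ℝ c a) ^ 2 := by
  simp only [PiLp.inner_apply, act_apply, RCLike.inner_apply, conj_trivial,
    Matrix.vecMulVec_apply, sq, Finset.sum_mul, Finset.mul_sum]
  rw [Finset.sum_comm]
  exact Finset.sum_congr rfl fun i _ => Finset.sum_congr rfl fun j _ => by ring

lemma continuous_act (M : Mat m n) : Continuous (act M) :=
  LinearMap.continuous_of_finiteDimensional (Matrix.toEuclideanLin M)

/-- The quadratic form of a square matrix. -/
def quad (Q : Mat n n) (c : Vec n) : ℝ := inner ℝ c (act Q c)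

/-- The seminorm `√(cᵀ Q c)`, which is the support function of the ellipsoid `E(0, Q)`. -/
def supp (Q : Mat n n) (c : Vec n) : ℝ := √(quad Q c)

lemma quad_eq_sum (Q : Mat n n) (c : Vec n) : quad Q c = ∑ i, ∑ j, Q i j * (c i * c j) := by
  simp only [quad, PiLp.inner_apply, act_apply, RCLike.inner_apply, conj_trivial, Finset.sum_mul]
  exact Finset.sum_congr rfl fun i _ => Finset.sum_congr rfl fun j _ => by ring

lemma quad_smul (Q : Mat n n) (a : ℝ) (c : Vec n) : quad Q (a • c) = a ^ 2 * quad Q c := by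
  simp [quad, inner_smul_left, inner_smul_right]; ring

lemma continuous_quad (Q : Mat n n) : Continuous (quad Q) :=
  continuous_id.inner (continuous_act Q)

lemma continuous_supp (Q : Mat n n) : Continuous (supp Q) := (continuous_quad Q).sqrt

lemma supp_nonneg (Q : Mat n n) (c : Vec n) : 0 ≤ supp Q c := Real.sqrt_nonneg _

lemma supp_smul (Q : Mat n n) (a : ℝ) (c : Vec n) : supp Q (a • c) = |a| * supp Q c := by
  rw [supp, quad_smul, Real.sqrt_mul (sq_nonneg a), Real.sqrt_sq_eq_abs, supp]

lemma quad_nonneg {Q : Mat n n} (hQ : Q.PosSemidef) (c : Vec n) : 0 ≤ quad Q c := by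
  have := hQ.dotProduct_mulVec_nonneg c.ofLp
  rw [quad_eq_sum]
  simpa [dotProduct, Matrix.mulVec, Finset.mul_sum, mul_comm, mul_left_comm, mul_assoc] using this

lemma supp_sq {Q : Mat n n} (hQ : Q.PosSemidef) (c : Vec n) : supp Q c ^ 2 = quad Q c :=
  Real.sq_sqrt (quad_nonneg hQ c)

lemma transpose_eq {Q : Mat n n} (hQ : Q.PosSemidef) : Qᵀ = Q := by
  simpa [Matrix.IsHermitian, Matrix.conjTranspose_eq_transpose_of_trivial] using hQ.isHermitian

lemma inner_act_comm {Q : Mat n n} (hQ : Q.PosSemidef) (x y : Vec n) :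
    inner ℝ x (act Q y) = inner ℝ y (act Q x) := by
  rw [inner_act, transpose_eq hQ, real_inner_comm]

lemma quad_le_of_loewner {P Q : Mat n n} (h : Loewner P Q) (c : Vec n) : quad P c ≤ quad Q c := by
  have := quad_nonneg h c
  simpa [quad, inner_sub_right] using this

end Act

/-! ### Ellipsoids -/

section Ellipsoid

variable {n : ℕ} {Q : Mat n n}

open scoped MatrixOrder in
lemma msqrt_posSemidef (Q : Mat n n) : (msqrt Q).PosSemidef :=
  Matrix.nonneg_iff_posSemidef.1 (CFC.sqrt_nonneg Q)

open scoped MatrixOrder in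
lemma msqrt_mul_msqrt (hQ : Q.PosSemidef) : msqrt Q * msqrt Q = Q :=
  CFC.sqrt_mul_sqrt_self Q hQ.nonneg

lemma act_msqrt_msqrt (hQ : Q.PosSemidef) (v : Vec n) :
    act (msqrt Q) (act (msqrt Q) v) = act Q v := by
  rw [← mul_act, msqrt_mul_msqrt hQ]

lemma quad_eq_norm_sq (hQ : Q.PosSemidef) (c : Vec n) : quad Q c = ‖act (msqrt Q) c‖ ^ 2 := by
  rw [quad, ← act_msqrt_msqrt hQ, inner_act, transpose_eq (msqrt_posSemidef Q),
    real_inner_self_eq_norm_sq]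

lemma supp_eq_norm (hQ : Q.PosSemidef) (c : Vec n) : supp Q c = ‖act (msqrt Q) c‖ := by
  rw [supp, quad_eq_norm_sq hQ, Real.sqrt_sq (norm_nonneg _)]

lemma act_eq_zero_of_supp (hQ : Q.PosSemidef) {c : Vec n} (h : supp Q c = 0) : act Q c = 0 := by
  rw [supp_eq_norm hQ, norm_eq_zero] at h
  rw [← act_msqrt_msqrt hQ, h, act_zero]

lemma supp_eq_zero {c : Vec n} (h : act Q c = 0) : supp Q c = 0 := by
  simp [supp, quad, h]

lemma act_msqrt_eq_zero (hQ : Q.PosSemidef) {c : Vec n} (h : act Q c = 0) :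
    act (msqrt Q) c = 0 := by
  rw [← norm_eq_zero, ← supp_eq_norm hQ, supp_eq_zero h]

lemma exists_act_eq_of_orthogonal_ker (hQ : Q.PosSemidef) {y : Vec n}
    (h : ∀ c, act Q c = 0 → inner ℝ c y = 0) : ∃ z, act Q z = y := by
  set R : Submodule ℝ (Vec n) := LinearMap.range (Matrix.toEuclideanLin Q)
  have hy : y ∈ Rᗮᗮ := by
    rw [Submodule.mem_orthogonal]
    intro c hc
    refine h c ?_
    rw [Submodule.mem_orthogonal] at hc
    have h0 := hc (act Q (act Q c)) ⟨_, rfl⟩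
    rw [real_inner_comm, inner_act, transpose_eq hQ, real_inner_self_eq_norm_sq] at h0
    exact norm_eq_zero.1 (pow_eq_zero_iff two_ne_zero |>.1 h0)
  rw [Submodule.orthogonal_orthogonal] at hy
  exact hy

lemma mem_ellipsoid_iff (hQ : Q.PosSemidef) {q y : Vec n} :
    y ∈ ellipsoid q Q ↔ ∃ z, supp Q z ≤ 1 ∧ y = q + act Q z := by
  constructor
  · rintro ⟨v, hv, rfl⟩
    set R : Submodule ℝ (Vec n) := LinearMap.range (Matrix.toEuclideanLin (msqrt Q))
    obtain ⟨z, hz⟩ : R.starProjection v ∈ R := Submodule.starProjection_apply_mem R v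
    have hz' : act (msqrt Q) z = R.starProjection v := hz
    refine ⟨z, ?_, ?_⟩
    · rw [supp_eq_norm hQ, hz']
      exact (R.norm_starProjection_apply_le v).trans hv
    · congr 1
      rw [← act_msqrt_msqrt hQ, hz', ← sub_eq_zero, ← act_sub, ← norm_eq_zero,
        ← sq_eq_zero_iff, ← real_inner_self_eq_norm_sq, inner_act,
        transpose_eq (msqrt_posSemidef Q)]
      exact Submodule.inner_right_of_mem_orthogonal (K := R) ⟨_, rfl⟩
        (Submodule.sub_starProjection_mem_orthogonal v)
  · rintro ⟨z, hz, rfl⟩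
    exact ⟨act (msqrt Q) z, by rwa [← supp_eq_norm hQ], by rw [act_msqrt_msqrt hQ]⟩

lemma inner_sub_le_supp (hQ : Q.PosSemidef) {q y : Vec n} (hy : y ∈ ellipsoid q Q) (c : Vec n) :
    inner ℝ c (y - q) ≤ supp Q c := by
  obtain ⟨v, hv, rfl⟩ := hy
  rw [add_sub_cancel_left, inner_act, transpose_eq (msqrt_posSemidef Q), supp_eq_norm hQ]
  exact (real_inner_le_norm _ _).trans (mul_le_of_le_one_right (norm_nonneg _) hv)

lemma exists_inner_act_msqrt_eq_supp (hQ : Q.PosSemidef) (c : Vec n) :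
    ∃ v : Vec n, ‖v‖ ≤ 1 ∧ inner ℝ c (act (msqrt Q) v) = supp Q c := by
  refine ⟨‖act (msqrt Q) c‖⁻¹ • act (msqrt Q) c, ?_, ?_⟩
  · rw [norm_smul, norm_inv, norm_norm]
    exact inv_mul_le_one
  · rw [act_smul, act_msqrt_msqrt hQ, inner_smul_right, ← quad, quad_eq_norm_sq hQ, supp_eq_norm hQ]
    rcases eq_or_ne ‖act (msqrt Q) c‖ 0 with h0 | h0
    · simp [h0]
    · field_simp

lemma isCompact_ellipsoid (q : Vec n) (Q : Mat n n) : IsCompact (ellipsoid q Q) := by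
  have : ellipsoid q Q = (fun v => q + act (msqrt Q) v) '' Metric.closedBall 0 1 := by
    ext y
    simp only [ellipsoid, mem_ofPred_eq, mem_image, Metric.mem_closedBall, dist_zero_right]
    exact exists_congr fun v => and_congr_right fun _ => eq_comm
  rw [this]
  exact (isCompact_closedBall _ _).image (continuous_const.add (continuous_act _))

lemma convex_ellipsoid (q : Vec n) (Q : Mat n n) : Convex ℝ (ellipsoid q Q) := by
  rintro _ ⟨v, hv, rfl⟩ _ ⟨w, hw, rfl⟩ a b ha hb hab
  refine ⟨a • v + b • w, ?_, ?_⟩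
  · calc ‖a • v + b • w‖ ≤ a * ‖v‖ + b * ‖w‖ := by
          refine (norm_add_le _ _).trans ?_
          rw [norm_smul, norm_smul, Real.norm_of_nonneg ha, Real.norm_of_nonneg hb]
      _ ≤ a * 1 + b * 1 := by gcongr
      _ = 1 := by linarith
  · simp only [act_add, act_smul, smul_add]
    rw [add_add_add_comm, ← add_smul, hab, one_smul]

lemma center_mem_ellipsoid (q : Vec n) (Q : Mat n n) : q ∈ ellipsoid q Q := ⟨0, by simp⟩

lemma add_mem_ellipsoid_iff {q ξ : Vec n} : q + ξ ∈ ellipsoid q Q ↔ ξ ∈ ellipsoid 0 Q := by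
  simp [ellipsoid]

lemma infDist_ellipsoid_eq_dist_iff (hQ : Q.PosSemidef) {q x p : Vec n} (hp : p ∈ ellipsoid q Q) :
    Metric.infDist x (ellipsoid q Q) = dist x p ↔
      supp Q (x - p) ≤ inner ℝ (x - p) (p - q) := by
  have hproj := norm_eq_iInf_iff_real_inner_le_zero (u := x) (convex_ellipsoid q Q) hp
  simp only [← dist_eq_norm, ← Metric.infDist_eq_iInf] at hproj
  have hsplit : ∀ y, inner ℝ (x - p) (y - p) =
      inner ℝ (x - p) (y - q) - inner ℝ (x - p) (p - q) := fun y => by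
    rw [← inner_sub_right, sub_sub_sub_cancel_right]
  rw [eq_comm, hproj]
  constructor
  · intro h
    obtain ⟨v, hv, hmax⟩ := exists_inner_act_msqrt_eq_supp hQ (x - p)
    have := h (q + act (msqrt Q) v) ⟨v, hv, rfl⟩
    rw [hsplit, add_sub_cancel_left, hmax] at this
    linarith
  · intro h y hy
    rw [hsplit]
    linarith [inner_sub_le_supp hQ hy (x - p)]

lemma exists_infDist_ellipsoid_eq_dist (q x : Vec n) (Q : Mat n n) :
    ∃ p ∈ ellipsoid q Q, Metric.infDist x (ellipsoid q Q) = dist x p :=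
  (isCompact_ellipsoid q Q).exists_infDist_eq_dist ⟨q, center_mem_ellipsoid q Q⟩ x

lemma inner_sub_supp_le_infDist (hQ : Q.PosSemidef) {q x c : Vec n} (hc : ‖c‖ ≤ 1) :
    inner ℝ c (x - q) - supp Q c ≤ Metric.infDist x (ellipsoid q Q) := by
  refine (Metric.le_infDist ⟨q, center_mem_ellipsoid q Q⟩).2 fun y hy => ?_
  calc inner ℝ c (x - q) - supp Q c ≤ inner ℝ c (x - q) - inner ℝ c (y - q) := by
        gcongr; exact inner_sub_le_supp hQ hy c
    _ = inner ℝ c (x - y) := by rw [← inner_sub_right, sub_sub_sub_cancel_right]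
    _ ≤ ‖x - y‖ := (real_inner_le_norm _ _).trans (mul_le_of_le_one_left (norm_nonneg _) hc)
    _ = dist x y := (dist_eq_norm x y).symm

lemma exists_infDist_ellipsoid_le (hQ : Q.PosSemidef) (q x : Vec n) :
    ∃ c : Vec n, ‖c‖ ≤ 1 ∧
      Metric.infDist x (ellipsoid q Q) ≤ inner ℝ c (x - q) - supp Q c := by
  obtain ⟨p, hp, hxp⟩ := exists_infDist_ellipsoid_eq_dist q x Q
  have hnormal := (infDist_ellipsoid_eq_dist_iff hQ hp).1 hxp
  refine ⟨‖x - p‖⁻¹ • (x - p), ?_, ?_⟩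
  · rw [norm_smul, norm_inv, norm_norm]
    exact inv_mul_le_one
  · calc Metric.infDist x (ellipsoid q Q) = ‖x - p‖⁻¹ * ‖x - p‖ ^ 2 := by
          rw [hxp, dist_eq_norm]
          rcases eq_or_ne ‖x - p‖ 0 with h0 | h0
          · simp [h0]
          · field_simp
      _ = ‖x - p‖⁻¹ * (inner ℝ (x - p) (x - q) - inner ℝ (x - p) (p - q)) := by
          rw [← inner_sub_right, sub_sub_sub_cancel_right, real_inner_self_eq_norm_sq]
      _ ≤ ‖x - p‖⁻¹ * (inner ℝ (x - p) (x - q) - supp Q (x - p)) := by gcongr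
      _ = inner ℝ (‖x - p‖⁻¹ • (x - p)) (x - q) - supp Q (‖x - p‖⁻¹ • (x - p)) := by
          rw [supp_smul, abs_of_nonneg (by positivity), real_inner_smul_left, mul_sub]

lemma mem_ellipsoid_of_forall_inner_le (hQ : Q.PosSemidef) {q y : Vec n}
    (h : ∀ c, inner ℝ c (y - q) ≤ supp Q c) : y ∈ ellipsoid q Q := by
  obtain ⟨c, -, hc⟩ := exists_infDist_ellipsoid_le hQ q y
  rw [(isCompact_ellipsoid q Q).isClosed.mem_iff_infDist_zero ⟨q, center_mem_ellipsoid q Q⟩]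
  exact le_antisymm (hc.trans (sub_nonpos.2 (h c))) Metric.infDist_nonneg

end Ellipsoid

/-! ### Measurable selection from convex inequalities -/

section Selection

open Filter Topology

variable {X D E : Type*} [NormedAddCommGroup E]

lemma exists_unique_min_norm [InnerProductSpace ℝ E] {F : Set E} (hF : IsComplete F)
    (hconv : Convex ℝ F) (hne : F.Nonempty) : ∃ M ∈ F, ∀ e ∈ F, ‖e‖ ≤ ‖M‖ → e = M := by
  obtain ⟨M, hM, hMmin⟩ := exists_norm_eq_iInf_of_complete_convex hne hF hconv 0
  have hproj := (norm_eq_iInf_iff_real_inner_le_zero hconv hM).1 hMmin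
  refine ⟨M, hM, fun e he hle => ?_⟩
  have hinner := hproj e he
  rw [zero_sub, inner_neg_left, inner_sub_right, real_inner_self_eq_norm_sq] at hinner
  have hsq : ‖e - M‖ ^ 2 ≤ 0 := by
    rw [norm_sub_sq_real, real_inner_comm]
    nlinarith [norm_nonneg e, norm_nonneg M]
  rw [← sub_eq_zero, ← norm_eq_zero]
  exact pow_eq_zero_iff two_ne_zero |>.1 (hsq.antisymm (sq_nonneg _))

/-- The penalty functional of the constraints `h i e ≤ 0`; as `k → ∞` its minimizers approach the
feasible point of least norm. -/
def penalty (h : ℕ → E → ℝ) (k : ℕ) (e : E) : ℝ :=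
  k * ∑ i ∈ Finset.range k, max (h i e) 0 + ‖e‖ ^ 2

lemma norm_sq_le_penalty (h : ℕ → E → ℝ) (k : ℕ) (e : E) : ‖e‖ ^ 2 ≤ penalty h k e :=
  le_add_of_nonneg_left <| mul_nonneg k.cast_nonneg <|
    Finset.sum_nonneg fun _ _ => le_max_right _ _

lemma mul_le_penalty (h : ℕ → E → ℝ) {i k : ℕ} (hik : i < k) (e : E) :
    k * h i e ≤ penalty h k e := by
  have hle : h i e ≤ ∑ i ∈ Finset.range k, max (h i e) 0 :=
    (le_max_left _ _).trans <| Finset.single_le_sum (f := fun i => max (h i e) 0)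
      (fun i _ => le_max_right _ _) (Finset.mem_range.2 hik)
  exact (mul_le_mul_of_nonneg_left hle k.cast_nonneg).trans (le_add_of_nonneg_right (sq_nonneg _))

lemma penalty_of_forall_nonpos {h : ℕ → E → ℝ} {e : E} (he : ∀ i, h i e ≤ 0) (k : ℕ) :
    penalty h k e = ‖e‖ ^ 2 := by
  simp [penalty, max_eq_right (he _)]

lemma continuous_penalty {h : ℕ → E → ℝ} (hc : ∀ i, Continuous (h i)) (k : ℕ) :
    Continuous (penalty h k) := by
  unfold penalty
  fun_prop

lemma nonpos_and_norm_le_of_tendsto_of_penalty_le {h : ℕ → E → ℝ} (hc : ∀ i, Continuous (h i))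
    {s : ℕ → E} {φ : ℕ → ℕ} (hφ : Tendsto φ atTop atTop) {r : ℝ} (hr : 0 ≤ r)
    (hs : ∀ k : ℕ, penalty h k (s k) ≤ r ^ 2 + 1 / ((k : ℝ) + 1)) {e : E}
    (he : Tendsto (s ∘ φ) atTop (𝓝 e)) : (∀ i, h i e ≤ 0) ∧ ‖e‖ ≤ r := by
  constructor
  · intro i
    have hlim : Tendsto (fun k => (r ^ 2 + 1) / (φ k : ℝ)) atTop (𝓝 0) :=
      (tendsto_natCast_atTop_atTop.comp hφ).const_div_atTop _
    refine le_of_tendsto_of_tendsto (((hc i).tendsto e).comp he) hlim ?_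
    filter_upwards [hφ.eventually_gt_atTop i] with k hk
    have hpos : (0 : ℝ) < φ k := by exact_mod_cast (Nat.zero_le i).trans_lt hk
    rw [le_div_iff₀ hpos, mul_comm]
    refine (mul_le_penalty h hk _).trans ((hs _).trans ?_)
    gcongr
    exact (div_le_one (by positivity)).2 (by linarith)
  · have hlim : Tendsto (fun k => r ^ 2 + 1 / ((φ k : ℝ) + 1)) atTop (𝓝 (r ^ 2)) := by
      simpa using tendsto_const_nhds.add
        ((tendsto_one_div_add_atTop_nhds_zero_nat (𝕜 := ℝ)).comp hφ)
    exact le_of_sq_le_sq (le_of_tendsto_of_tendsto' (he.norm.pow 2) hlim fun k =>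
      (norm_sq_le_penalty h _ _).trans (hs _)) hr

lemma tendsto_of_penalty_le [ProperSpace E] {h : ℕ → E → ℝ} (hc : ∀ i, Continuous (h i)) {M : E}
    (hM : ∀ e, (∀ i, h i e ≤ 0) → ‖e‖ ≤ ‖M‖ → e = M) {s : ℕ → E}
    (hs : ∀ k : ℕ, penalty h k (s k) ≤ ‖M‖ ^ 2 + 1 / ((k : ℝ) + 1)) :
    Tendsto s atTop (𝓝 M) := by
  have hball : ∀ k, s k ∈ Metric.closedBall (0 : E) (‖M‖ + 1) := fun k => by
    have hone : 1 / ((k : ℝ) + 1) ≤ 1 := (div_le_one (by positivity)).2 (by simp)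
    rw [mem_closedBall_zero_iff]
    refine le_of_sq_le_sq ?_ (by positivity)
    nlinarith [norm_sq_le_penalty h k (s k), hs k, norm_nonneg M]
  refine tendsto_of_subseq_tendsto fun ns hns => ?_
  obtain ⟨e, -, ms, hms, hlim⟩ := tendsto_subseq_of_bounded Metric.isBounded_closedBall
    fun k => hball (ns k)
  obtain ⟨he, hle⟩ := nonpos_and_norm_le_of_tendsto_of_penalty_le hc
    (hns.comp hms.tendsto_atTop) (norm_nonneg M) hs hlim
  exact ⟨ms, hM e he hle ▸ hlim⟩

lemma exists_measurable_le_add [TopologicalSpace D] [TopologicalSpace.SeparableSpace D] [Nonempty D]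
    [MeasurableSpace X] [MeasurableSpace D] {J : X → D → ℝ} (hm : ∀ d, Measurable fun x => J x d)
    (hc : ∀ x, Continuous (J x)) (hb : ∀ x, BddBelow (range (J x))) {ε : ℝ} (hε : 0 < ε) :
    ∃ s : X → D, Measurable s ∧ ∀ x d, J x (s x) ≤ J x d + ε := by
  classical
  set d := TopologicalSpace.denseSeq D
  have hbd : ∀ x, BddBelow (range fun j => J x (d j)) := fun x =>
    (hb x).mono (range_comp_subset_range d (J x))
  have hex : ∀ x, ∃ j, J x (d j) < (⨅ j, J x (d j)) + ε := fun x =>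
    exists_lt_of_ciInf_lt (lt_add_of_pos_right _ hε)
  refine ⟨fun x => d (Nat.find (hex x)), (measurable_from_nat (f := d)).comp
    (measurable_find hex fun j => measurableSet_lt (hm (d j))
      ((Measurable.iInf fun j => hm (d j)).add_const _)), fun x e => ?_⟩
  refine (Nat.find_spec (hex x)).le.trans (add_le_add_left ?_ _)
  refine le_of_forall_pos_lt_add fun δ hδ => ?_
  obtain ⟨j, hj⟩ := (TopologicalSpace.denseRange_denseSeq D).exists_mem_open
    ((hc x).isOpen_preimage _ (isOpen_Iio (a := J x e + δ))) ⟨e, by simp [hδ]⟩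
  exact (ciInf_le (hbd x) j).trans_lt hj

lemma exists_measurable_selection_of_innerProductSpace [MeasurableSpace X] [InnerProductSpace ℝ E]
    [FiniteDimensional ℝ E] [MeasurableSpace E] [BorelSpace E] {h : ℕ → X → E → ℝ}
    (hm : ∀ i e, Measurable fun x => h i x e) (hc : ∀ i x, Continuous (h i x))
    (hconv : ∀ x, Convex ℝ {e | ∀ i, h i x e ≤ 0}) (hne : ∀ x, ∃ e, ∀ i, h i x e ≤ 0) :
    ∃ s : X → E, Measurable s ∧ ∀ i x, h i x (s x) ≤ 0 := by
  have hclosed : ∀ x, IsClosed {e | ∀ i, h i x e ≤ 0} := fun x => by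
    simp only [ofPred_forall]
    exact isClosed_iInter fun i => isClosed_le (hc i x) continuous_const
  choose M hM hMuniq using fun x =>
    exists_unique_min_norm (hclosed x).isComplete (hconv x) (hne x)
  have hJm : ∀ k e, Measurable fun x => penalty (fun i => h i x) k e := fun k e => by
    unfold penalty
    exact ((Finset.measurable_sum _ fun i _ =>
      (hm i e).max measurable_const).const_mul _).add_const _
  choose s hsm hs using fun k : ℕ => exists_measurable_le_add (hJm k)
    (fun x => continuous_penalty (fun i => hc i x) k)
    (fun x => ⟨0, by
      rintro _ ⟨e, rfl⟩
      exact (sq_nonneg _).trans (norm_sq_le_penalty _ k e)⟩)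
    (Nat.one_div_pos_of_nat (α := ℝ) (n := k))
  have htend : ∀ x, Tendsto (fun k => s k x) atTop (𝓝 (M x)) := fun x =>
    tendsto_of_penalty_le (fun i => hc i x) (hMuniq x) fun k =>
      (hs k x (M x)).trans_eq (by rw [penalty_of_forall_nonpos (hM x)])
  exact ⟨M, measurable_of_tendsto_metrizable hsm (tendsto_pi_nhds.2 htend), fun i x => hM x i⟩

theorem exists_measurable_selection [MeasurableSpace X] [TopologicalSpace D]
    [TopologicalSpace.SeparableSpace D] [Nonempty D] [NormedSpace ℝ E] [FiniteDimensional ℝ E]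
    [MeasurableSpace E] [BorelSpace E] {h : D → X → E → ℝ}
    (hm : ∀ d e, Measurable fun x => h d x e) (hc : ∀ d x, Continuous (h d x))
    (hcd : ∀ x e, Continuous fun d => h d x e) (hconv : ∀ d x, Convex ℝ {e | h d x e ≤ 0})
    (hne : ∀ x, ∃ e, ∀ d, h d x e ≤ 0) :
    ∃ s : X → E, Measurable s ∧ ∀ d x, h d x (s x) ≤ 0 := by
  let e := toEuclidean (E := E)
  let d := TopologicalSpace.denseSeq D
  obtain ⟨s, hs, hle⟩ := exists_measurable_selection_of_innerProductSpace
    (h := fun i x y => h (d i) x (e.symm y)) (fun i y => hm _ _)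
    (fun i x => (hc _ x).comp e.symm.continuous)
    (fun x => by
      simp only [ofPred_forall]
      exact convex_iInter fun i => (hconv (d i) x).linear_preimage e.symm.toLinearMap)
    (fun x => let ⟨y, hy⟩ := hne x; ⟨e y, fun i => by simpa using hy (d i)⟩)
  refine ⟨fun x => e.symm (s x), e.symm.continuous.measurable.comp hs, fun c x => ?_⟩
  have hdense : DenseRange d := TopologicalSpace.denseRange_denseSeq D
  exact hdense.induction_on (p := fun c => h c x (e.symm (s x)) ≤ 0) c
    (isClosed_le (hcd x _) continuous_const) fun i => hle i x

end Selection

/-! ### Absolutely continuous and one-sided Lipschitz functions -/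

section Analysis

open Filter Topology

lemma absolutelyContinuousOnInterval_comp_of_lipschitzOnWith {X Y : Type*} [PseudoMetricSpace X]
    [PseudoMetricSpace Y] {f : ℝ → X} {g : X → Y} {s : Set X} {C : NNReal} {a b : ℝ}
    (hg : LipschitzOnWith C g s) (hf : AbsolutelyContinuousOnInterval f a b)
    (hs : MapsTo f (uIcc a b) s) : AbsolutelyContinuousOnInterval (fun t => g (f t)) a b := by
  rw [absolutelyContinuousOnInterval_iff] at hf ⊢
  intro ε hε
  obtain ⟨δ, hδ, h⟩ := hf (ε / (C + 1)) (by positivity)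
  refine ⟨δ, hδ, fun E hE hlt => ?_⟩
  have hsum := h E hE hlt
  rw [lt_div_iff₀ (by positivity), Finset.sum_mul] at hsum
  refine (Finset.sum_le_sum fun i hi => ?_).trans_lt hsum
  have hmem := hE.1 i hi
  calc dist (g (f (E.2 i).1)) (g (f (E.2 i).2)) ≤ C * dist (f (E.2 i).1) (f (E.2 i).2) :=
        hg.dist_le_mul _ (hs hmem.1) _ (hs hmem.2)
    _ ≤ dist (f (E.2 i).1) (f (E.2 i).2) * (C + 1) := by
        rw [mul_comm]
        gcongr
        exact le_add_of_nonneg_right zero_le_one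

lemma absolutelyContinuousOnInterval_sum {ι : Type*} (s : Finset ι) {φ : ι → ℝ → ℝ} {a b : ℝ}
    (h : ∀ i ∈ s, AbsolutelyContinuousOnInterval (φ i) a b) :
    AbsolutelyContinuousOnInterval (fun t => ∑ i ∈ s, φ i t) a b := by
  classical
  induction s using Finset.induction_on with
  | empty =>
    simp only [Finset.sum_empty]
    exact ((LipschitzWith.const (0 : ℝ)).lipschitzOnWith
      (s := uIcc a b)).absolutelyContinuousOnInterval
  | insert i s hi ih =>
    simp only [Finset.sum_insert hi]
    exact (h i (by simp)).add (ih fun j hj => h j (by simp [hj]))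

lemma sub_le_of_absolutelyContinuous_of_ae_hasDerivAt_le {φ : ℝ → ℝ} {a b C : ℝ}
    (hab : a ≤ b) (hφ : AbsolutelyContinuousOnInterval φ a b)
    (h : ∀ᵐ t, t ∈ Ioo a b → ∀ d, HasDerivAt φ d t → d ≤ C) : φ b - φ a ≤ C * (b - a) := by
  have hint : ∫ t in a..b, deriv φ t ≤ ∫ _ in a..b, C := by
    refine intervalIntegral.integral_mono_ae_restrict hab hφ.intervalIntegrable_deriv (by simp) ?_
    rw [← restrict_Ioo_eq_restrict_Icc, EventuallyLE, ae_restrict_iff' measurableSet_Ioo]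
    filter_upwards [h, hφ.ae_differentiableAt] with t ht hd hmem
    exact ht hmem _ (hd (uIcc_of_le hab ▸ Ioo_subset_Icc_self hmem)).hasDerivAt
  rw [← hφ.integral_deriv_eq_sub]
  simpa [mul_comm] using hint

/-- `C * t - g t` is nondecreasing, so it grows by at least the integral of its derivative. -/
lemma le_of_antitoneOn_sub_of_ae_deriv_nonpos {g : ℝ → ℝ} {a b C : ℝ} (hab : a ≤ b)
    (hanti : AntitoneOn (fun t => g t - C * t) (Icc a b))
    (h : ∀ᵐ t, t ∈ Ioo a b → ∀ d, HasDerivAt g d t → d ≤ 0) : g b ≤ g a := by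
  set φ : ℝ → ℝ := fun t => C * t - g t with hφ
  have hmono : MonotoneOn φ (Icc a b) := by simpa [hφ, Pi.neg_def] using hanti.neg
  have hmono' : MonotoneOn φ (uIcc a b) := by rwa [uIcc_of_le hab]
  have hφab : φ a ≤ φ b := hmono (left_mem_Icc.2 hab) (right_mem_Icc.2 hab) hab
  have hle : ∫ t in a..b, deriv φ t ≤ φ b - φ a := by
    have hmem := hmono'.intervalIntegral_deriv_mem_uIcc
    rw [uIcc_of_le (sub_nonneg.2 hφab)] at hmem
    exact hmem.2
  have hge : ∫ _ in a..b, C ≤ ∫ t in a..b, deriv φ t := by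
    refine intervalIntegral.integral_mono_ae_restrict hab (by simp)
      hmono'.intervalIntegrable_deriv ?_
    rw [← restrict_Ioo_eq_restrict_Icc, EventuallyLE, ae_restrict_iff' measurableSet_Ioo]
    filter_upwards [h, hmono.ae_differentiableWithinAt_of_mem] with t ht hd hmem
    have hφ' := ((hd (Ioo_subset_Icc_self hmem)).differentiableAt
      (Icc_mem_nhds hmem.1 hmem.2)).hasDerivAt
    have hg : HasDerivAt g (C - deriv φ t) t := by
      have hlin : HasDerivAt (fun s => C * s) C t := by
        simpa using (hasDerivAt_id t).const_mul C
      exact (hlin.sub hφ').congr_of_eventuallyEq (Eventually.of_forall fun s => by simp [hφ])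
    linarith [ht hmem _ hg]
  simp only [intervalIntegral.integral_const, smul_eq_mul] at hge
  simp only [hφ] at hle
  linarith

lemma antitoneOn_exp_mul_sub {D : ℝ → ℝ} {a b C L : ℝ} (hL : 0 ≤ L) (hC : 0 ≤ C)
    (hD : ∀ t, 0 ≤ D t) (hanti : AntitoneOn (fun t => D t - C * t) (Icc a b)) :
    AntitoneOn (fun t => Real.exp (-L * t) * D t - Real.exp (-L * a) * C * t) (Icc a b) := by
  intro t ht t' ht' htt'
  have hstep : D t' ≤ D t + C * (t' - t) := by linarith [hanti ht ht' htt']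
  have hsum : Real.exp (-L * t') * D t' ≤
      Real.exp (-L * t) * D t + Real.exp (-L * a) * (C * (t' - t)) := by
    calc Real.exp (-L * t') * D t'
        ≤ Real.exp (-L * t') * D t + Real.exp (-L * t') * (C * (t' - t)) := by
          rw [← mul_add]; gcongr
      _ ≤ _ := by
          have hexp : Real.exp (-L * t') ≤ Real.exp (-L * t) :=
            Real.exp_le_exp.2 (by nlinarith)
          have hexpa : Real.exp (-L * t') ≤ Real.exp (-L * a) :=
            Real.exp_le_exp.2 (by nlinarith [ht'.1])
          exact add_le_add (mul_le_mul_of_nonneg_right hexp (hD t))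
            (mul_le_mul_of_nonneg_right hexpa (mul_nonneg hC (sub_nonneg.2 htt')))
  simp only
  linarith

lemma eq_zero_of_antitoneOn_sub_of_ae_deriv_le {D : ℝ → ℝ} {a b C L : ℝ} (hab : a ≤ b)
    (hL : 0 ≤ L) (hC : 0 ≤ C) (hD : ∀ t, 0 ≤ D t)
    (hanti : AntitoneOn (fun t => D t - C * t) (Icc a b))
    (h : ∀ᵐ t, t ∈ Ioo a b → ∀ d, HasDerivAt D d t → d ≤ L * D t) (ha : D a = 0) : D b = 0 := by
  have hdecay : Real.exp (-L * b) * D b ≤ Real.exp (-L * a) * D a := by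
    refine le_of_antitoneOn_sub_of_ae_deriv_nonpos (g := fun t => Real.exp (-L * t) * D t)
      hab (antitoneOn_exp_mul_sub hL hC hD hanti) ?_
    filter_upwards [h] with t ht hmem d hd
    have hcancel : ∀ s, Real.exp (L * s) * Real.exp (-L * s) = 1 := fun s => by
      rw [← Real.exp_add]; simp
    have hexp : HasDerivAt (fun t => Real.exp (L * t)) (Real.exp (L * t) * L) t := by
      simpa using ((hasDerivAt_id t).const_mul L).exp
    have hDd : HasDerivAt D (L * D t + Real.exp (L * t) * d) t := by
      refine ((hexp.mul hd).congr_of_eventuallyEq (Eventually.of_forall fun s => ?_)).congr_deriv ?_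
      · simp [← mul_assoc, ← Real.exp_add]
      · linear_combination L * D t * hcancel t
    have hle := ht hmem _ hDd
    exact nonpos_of_mul_nonpos_right (by linarith) (Real.exp_pos (L * t))
  rw [ha, mul_zero] at hdecay
  exact le_antisymm (nonpos_of_mul_nonpos_right hdecay (Real.exp_pos _)) (hD b)

lemma deriv_le_norm_of_le_norm {E : Type*} [NormedAddCommGroup E] [NormedSpace ℝ E] {D : ℝ → ℝ}
    {g : ℝ → E} {t d : ℝ} {g' : E} (hD : HasDerivAt D d t) (hg : HasDerivWithinAt g g' (Ioi t) t)
    (heq : D t = ‖g t‖) (hle : ∀ᶠ s in 𝓝[>] t, D s ≤ ‖g s‖) : d ≤ ‖g'‖ := by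
  have hDslope :=
    (hasDerivWithinAt_iff_tendsto_slope' (by simp)).1 (hD.hasDerivWithinAt (s := Ioi t))
  have hgslope := ((hasDerivWithinAt_iff_tendsto_slope' (by simp)).1 hg).norm
  refine le_of_tendsto_of_tendsto hDslope hgslope ?_
  filter_upwards [hle, self_mem_nhdsWithin] with s hs hts
  have hpos : 0 < s - t := sub_pos.2 hts
  rw [slope_def_field, slope_def_module, norm_smul, norm_inv, Real.norm_of_nonneg hpos.le,
    div_eq_inv_mul, heq]
  gcongr
  linarith [norm_sub_norm_le (g s) (g t)]

lemma hasDerivWithinAt_max_one {ρ : ℝ → ℝ} {t ρ' : ℝ} (hρ : HasDerivAt ρ ρ' t) (hle : ρ t ≤ 1)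
    (h : ρ t = 1 → ρ' ≤ 0) : HasDerivWithinAt (fun s => max 1 (ρ s)) 0 (Ioi t) t := by
  rcases hle.lt_or_eq with hlt | heq
  · have : (fun s => max 1 (ρ s)) =ᶠ[𝓝 t] fun _ => 1 := by
      filter_upwards [hρ.continuousAt.eventually_lt continuousAt_const hlt] with s hs
      exact max_eq_left hs.le
    exact ((hasDerivAt_const t (1 : ℝ)).congr_of_eventuallyEq this).hasDerivWithinAt
  · have hslope : Tendsto (slope ρ t) (𝓝[>] t) (𝓝 ρ') :=
      (hasDerivWithinAt_iff_tendsto_slope' (by simp)).1 hρ.hasDerivWithinAt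
    have hmax : Tendsto (fun s => max 0 (slope ρ t s)) (𝓝[>] t) (𝓝 0) := by
      simpa [h heq] using (tendsto_const_nhds (x := (0 : ℝ))).max hslope
    rw [hasDerivWithinAt_iff_tendsto_slope' (by simp)]
    refine hmax.congr' ?_
    filter_upwards [self_mem_nhdsWithin] with s hs
    have hpos : 0 < s - t := sub_pos.2 hs
    rw [slope_def_field, slope_def_field, heq, max_self]
    rcases le_total 1 (ρ s) with h1 | h1
    · rw [max_eq_right h1, max_eq_right (div_nonneg (sub_nonneg.2 h1) hpos.le)]
    · rw [max_eq_left h1, max_eq_left (div_nonpos_of_nonpos_of_nonneg (by linarith) hpos.le)]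
      simp

lemma lipschitzOnWith_sqrt_add {ε : ℝ} (hε : 0 < ε) :
    LipschitzOnWith (Real.toNNReal (√ε)⁻¹) (fun y => √(y + ε)) (Ici 0) := by
  refine LipschitzOnWith.of_dist_le_mul fun y (hy : 0 ≤ y) y' (hy' : 0 ≤ y') => ?_
  have hsq : (√(y + ε) - √(y' + ε)) * (√(y + ε) + √(y' + ε)) = y - y' := by
    rw [mul_comm, ← sq_sub_sq, Real.sq_sqrt (by linarith), Real.sq_sqrt (by linarith)]
    ring
  have hge : √ε ≤ √(y + ε) + √(y' + ε) :=
    le_add_of_le_of_nonneg (Real.sqrt_le_sqrt (by linarith)) (Real.sqrt_nonneg _)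
  rw [Real.coe_toNNReal _ (by positivity), Real.dist_eq, Real.dist_eq, ← hsq, abs_mul,
    inv_mul_eq_div, le_div_iff₀ (Real.sqrt_pos.2 hε),
    abs_of_nonneg ((Real.sqrt_nonneg _).trans hge)]
  gcongr

end Analysis

/-! ### Moving ellipsoids -/

section MovingEllipsoid

open Filter Topology

variable {m n : ℕ}

lemma hasDerivAt_vec_iff {φ : ℝ → Vec n} {φ' : Vec n} {t : ℝ} :
    HasDerivAt φ φ' t ↔ ∀ i, HasDerivAt (fun s => φ s i) (φ' i) t := by
  refine ⟨fun h i => (EuclideanSpace.proj (𝕜 := ℝ) i).hasFDerivAt.comp_hasDerivAt t h,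
    fun h => ?_⟩
  exact (PiLp.continuousLinearEquiv 2 ℝ fun _ : Fin n => ℝ).symm.hasFDerivAt.comp_hasDerivAt t
    (hasDerivAt_pi.2 h : HasDerivAt (fun s => (φ s).ofLp) φ'.ofLp t)

/-- Entrywise differentiability of a matrix-valued function of time, the counterpart of `matDeriv`;
no norm on matrices is involved. -/
def HasMatDerivAt (Q : ℝ → Mat m n) (Q' : Mat m n) (t : ℝ) : Prop :=
  ∀ i j, HasDerivAt (fun s => Q s i j) (Q' i j) t

lemma HasMatDerivAt.act {Q : ℝ → Mat m n} {Q' : Mat m n} {z : ℝ → Vec n} {z' : Vec n} {t : ℝ}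
    (hQ : HasMatDerivAt Q Q' t) (hz : HasDerivAt z z' t) :
    HasDerivAt (fun s => act (Q s) (z s)) (act Q' (z t) + act (Q t) z') t := by
  refine hasDerivAt_vec_iff.2 fun i => ?_
  simp only [act_apply, PiLp.add_apply, ← Finset.sum_add_distrib]
  exact HasDerivAt.fun_sum fun j _ => (hQ i j).mul (hasDerivAt_vec_iff.1 hz j)

lemma HasMatDerivAt.quad {Q : ℝ → Mat n n} {Q' : Mat n n} {t : ℝ} (hQ : HasMatDerivAt Q Q' t)
    (c : Vec n) : HasDerivAt (fun s => quad (Q s) c) (quad Q' c) t := by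
  simpa [EllTube.quad] using (hasDerivAt_const t c).inner ℝ (hQ.act (hasDerivAt_const t c))

/-- `s ↦ cᵀ Q(s) c` has a minimum at `t`. -/
lemma HasMatDerivAt.quad_eq_zero {Q : ℝ → Mat n n} {Q' : Mat n n} {t : ℝ}
    (hQ : HasMatDerivAt Q Q' t) (hpsd : ∀ᶠ s in 𝓝 t, (Q s).PosSemidef) {c : Vec n}
    (hc : EllTube.act (Q t) c = 0) : EllTube.quad Q' c = 0 := by
  refine IsLocalMin.hasDerivAt_eq_zero (f := fun s => EllTube.quad (Q s) c) ?_ (hQ.quad c)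
  filter_upwards [hpsd] with s hs
  rw [show EllTube.quad (Q t) c = 0 by simp [EllTube.quad, hc]]
  exact quad_nonneg hs c

lemma ae_hasMatDerivAt {Q : ℝ → Mat m n} {a b : ℝ}
    (hQ : ∀ i j, AbsolutelyContinuousOnInterval (fun t => Q t i j) a b) :
    ∀ᵐ t, t ∈ uIcc a b → HasMatDerivAt Q (matDeriv Q t) t := by
  have hdiff : ∀ᵐ t, ∀ i j, t ∈ uIcc a b → DifferentiableAt ℝ (fun t => Q t i j) t :=
    ae_all_iff.2 fun i => ae_all_iff.2 fun j => (hQ i j).ae_differentiableAt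
  filter_upwards [hdiff] with t ht hmem i j
  exact (ht i j hmem).hasDerivAt

lemma ae_quad_matDeriv_eq_zero {Q : ℝ → Mat n n} {a b : ℝ}
    (hQ : ∀ i j, AbsolutelyContinuousOnInterval (fun t => Q t i j) a b)
    (hpsd : ∀ t ∈ Icc a b, (Q t).PosSemidef) :
    ∀ᵐ t, t ∈ Ioo a b → ∀ c, act (Q t) c = 0 → quad (matDeriv Q t) c = 0 := by
  filter_upwards [ae_hasMatDerivAt hQ] with t hQ' ht c hc
  refine (hQ' (Icc_subset_uIcc (Ioo_subset_Icc_self ht))).quad_eq_zero ?_ hc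
  filter_upwards [Icc_mem_nhds ht.1 ht.2] with s hs using hpsd s hs

lemma absolutelyContinuousOnInterval_inner {x : ℝ → Vec n} {a b : ℝ}
    (hx : AbsolutelyContinuousOnInterval x a b) (c : Vec n) :
    AbsolutelyContinuousOnInterval (fun t => inner ℝ c (x t)) a b :=
  absolutelyContinuousOnInterval_comp_of_lipschitzOnWith
    (innerSL ℝ c).lipschitz.lipschitzOnWith hx (mapsTo_univ _ _)

lemma ae_hasDerivAt_of_absolutelyContinuous {x : ℝ → Vec n} {a b : ℝ}
    (hx : AbsolutelyContinuousOnInterval x a b) :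
    ∀ᵐ t, t ∈ uIcc a b → HasDerivAt x (deriv x t) t := by
  filter_upwards [hx.boundedVariationOn.ae_differentiableAt_of_mem_uIcc] with t ht hmem
  exact (ht hmem).hasDerivAt

lemma absolutelyContinuousOnInterval_quad {Q : ℝ → Mat n n} {a b : ℝ}
    (hQ : ∀ i j, AbsolutelyContinuousOnInterval (fun t => Q t i j) a b) (c : Vec n) :
    AbsolutelyContinuousOnInterval (fun t => quad (Q t) c) a b := by
  simp only [quad_eq_sum]
  refine absolutelyContinuousOnInterval_sum _ fun i _ =>
    absolutelyContinuousOnInterval_sum _ fun j _ => ?_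
  simpa [mul_comm] using (hQ i j).const_mul (c i * c j)

/-- First order conditions for `T` to be the velocity, relative to the centre, of a curve in a
moving ellipsoid through the point `q + Q z`, where `Q'` is the velocity of the shape matrix `Q`.
The condition `range` is void for invertible `Q`; when `Q` is singular it keeps the curve in the
affine hull of the ellipsoid. -/
structure IsTangent (Q Q' : Mat n n) (z T : Vec n) : Prop where
  range : ∃ ζ, act Q ζ = T - act Q' z
  inward : supp Q z = 1 → 2 * inner ℝ z T ≤ quad Q' z

variable {Q : ℝ → Mat n n} {Q' : Mat n n} {t : ℝ}

/-- With `Z(s) = z + (s - t) ζ` the curve `q + Q Z` has the right velocity; dividing by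
`max 1 (Zᵀ Q Z)`, whose right derivative at `t` vanishes, keeps it in the ellipsoid. -/
lemma IsTangent.exists_curve_mem_ellipsoid {q : ℝ → Vec n} {q' z T : Vec n}
    (hT : IsTangent (Q t) Q' z T) (hq : HasDerivAt q q' t) (hQ : HasMatDerivAt Q Q' t)
    (hpsd : ∀ᶠ s in 𝓝 t, (Q s).PosSemidef) (hz : supp (Q t) z ≤ 1) :
    ∃ y : ℝ → Vec n, HasDerivWithinAt y (q' + T) (Ioi t) t ∧ y t = q t + act (Q t) z ∧
      ∀ᶠ s in 𝓝[>] t, y s ∈ ellipsoid (q s) (Q s) := by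
  have hpsdt : (Q t).PosSemidef := hpsd.self_of_nhds
  obtain ⟨ζ, hζ⟩ := hT.range
  set Z : ℝ → Vec n := fun s => z + (s - t) • ζ with hZ
  have hZt : Z t = z := by simp [hZ]
  have hZd : HasDerivAt Z ζ t := by
    simpa [hZ] using (((hasDerivAt_id t).sub_const t).smul_const ζ).const_add z
  have hQZ : HasDerivAt (fun s => act (Q s) (Z s)) T t :=
    (hQ.act hZd).congr_deriv (by rw [hZt, hζ, add_sub_cancel])
  set ρ : ℝ → ℝ := fun s => quad (Q s) (Z s) with hρ
  have hρd : HasDerivAt ρ (2 * inner ℝ z T - quad Q' z) t :=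
    (hZd.inner ℝ hQZ).congr_deriv <| by
      rw [hZt, inner_act_comm hpsdt, hζ, inner_sub_right, quad]
      ring
  have hρt : ρ t = supp (Q t) z ^ 2 := by simp only [hρ, hZt, supp_sq hpsdt]
  have hρle : ρ t ≤ 1 := hρt ▸ pow_le_one₀ (supp_nonneg _ _) hz
  have hmaxt : max 1 (ρ t) = 1 := max_eq_left hρle
  have hmax := hasDerivWithinAt_max_one hρd hρle fun h => by
    rw [hρt, pow_eq_one_iff_of_nonneg (supp_nonneg _ _) two_ne_zero] at h
    linarith [hT.inward h]
  refine ⟨fun s => q s + (max 1 (ρ s))⁻¹ • act (Q s) (Z s), ?_, ?_, ?_⟩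
  · refine (hq.hasDerivWithinAt.add ((hmax.inv (by rw [hmaxt]; exact one_ne_zero)).smul
      (hQZ.hasDerivWithinAt (s := Ioi t)))).congr_deriv ?_
    simp [hmaxt]
  · simp [hmaxt, hZt]
  · filter_upwards [hpsd.filter_mono nhdsWithin_le_nhds] with s hs
    refine (mem_ellipsoid_iff hs).2 ⟨(max 1 (ρ s))⁻¹ • Z s, ?_, by rw [act_smul]⟩
    have hpos : 0 < max 1 (ρ s) := one_pos.trans_le (le_max_left _ _)
    rw [supp_smul, abs_of_pos (inv_pos.2 hpos), inv_mul_le_iff₀ hpos, mul_one, supp,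
      Real.sqrt_le_left hpos.le]
    nlinarith [le_max_left 1 (ρ s), le_max_right 1 (ρ s)]

lemma IsTangent.deriv_infDist_le {x q : ℝ → Vec n} {x' q' z T : Vec n} {d : ℝ}
    (hT : IsTangent (Q t) Q' z T) (hx : HasDerivAt x x' t) (hq : HasDerivAt q q' t)
    (hQ : HasMatDerivAt Q Q' t) (hpsd : ∀ᶠ s in 𝓝 t, (Q s).PosSemidef) (hz : supp (Q t) z ≤ 1)
    (hnear : Metric.infDist (x t) (ellipsoid (q t) (Q t)) = dist (x t) (q t + act (Q t) z))
    (hd : HasDerivAt (fun s => Metric.infDist (x s) (ellipsoid (q s) (Q s))) d t) :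
    d ≤ ‖x' - (q' + T)‖ := by
  obtain ⟨y, hy, hyt, hmem⟩ := hT.exists_curve_mem_ellipsoid hq hQ hpsd hz
  refine deriv_le_norm_of_le_norm hd (hx.hasDerivWithinAt.sub hy) ?_ ?_
  · rw [hnear, Pi.sub_apply, hyt, dist_eq_norm]
  · filter_upwards [hmem] with s hs
    rw [Pi.sub_apply, ← dist_eq_norm]
    exact Metric.infDist_le_dist_of_mem hs

lemma neg_le_quad_of_isTangent {Q : Mat n n} (hQ : Q.PosSemidef)
    (hQ' : ∀ c, act Q c = 0 → quad Q' c = 0) {B : ℝ}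
    (h : ∀ z, supp Q z = 1 → ∃ T, ‖T‖ ≤ B ∧ IsTangent Q Q' z T) (c : Vec n) :
    -(2 * B * supp Q c * ‖c‖) ≤ quad Q' c := by
  rcases (supp_nonneg Q c).eq_or_lt with h0 | hpos
  · rw [hQ' c (act_eq_zero_of_supp hQ h0.symm), ← h0]
    simp
  set r := supp Q c
  obtain ⟨T, hTB, hT⟩ := h (r⁻¹ • c) (by
    rw [supp_smul, abs_of_pos (inv_pos.2 hpos), inv_mul_cancel₀ hpos.ne'])
  have hinward := hT.inward (by
    rw [supp_smul, abs_of_pos (inv_pos.2 hpos), inv_mul_cancel₀ hpos.ne'])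
  rw [real_inner_smul_left, quad_smul] at hinward
  have hcT : -(‖c‖ * B) ≤ inner ℝ c T := by
    have := mul_le_mul_of_nonneg_left hTB (norm_nonneg c)
    linarith [neg_le_of_abs_le (abs_real_inner_le_norm c T)]
  calc -(2 * B * r * ‖c‖) = 2 * r * -(‖c‖ * B) := by ring
    _ ≤ 2 * r * inner ℝ c T := by gcongr
    _ = r ^ 2 * (2 * (r⁻¹ * inner ℝ c T)) := by field_simp
    _ ≤ r ^ 2 * (r⁻¹ ^ 2 * quad Q' c) := mul_le_mul_of_nonneg_left hinward (sq_nonneg r)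
    _ = quad Q' c := by field_simp

section Distance

variable {x q : ℝ → Vec n} {a b B : ℝ}

/-- The support function is smoothed to `√(cᵀ Q c + ε)`, which is differentiable also at times when
`c` is in the kernel of `Q`. -/
lemma inner_sub_sqrt_le_add {ε : ℝ} (hε : 0 < ε) (hab : a ≤ b) (hB : 0 ≤ B)
    (hx : AbsolutelyContinuousOnInterval x a b) (hq : AbsolutelyContinuousOnInterval q a b)
    (hQ : ∀ i j, AbsolutelyContinuousOnInterval (fun t => Q t i j) a b)
    (hpsd : ∀ t ∈ Icc a b, (Q t).PosSemidef) {c : Vec n} (hc : ‖c‖ ≤ 1)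
    (hvel : ∀ᵐ t, t ∈ Ioo a b → ‖deriv x t - deriv q t‖ ≤ B)
    (hshape : ∀ᵐ t, t ∈ Ioo a b → -(2 * B * supp (Q t) c * ‖c‖) ≤ quad (matDeriv Q t) c) :
    inner ℝ c (x b - q b) - √(quad (Q b) c + ε) -
      (inner ℝ c (x a - q a) - √(quad (Q a) c + ε)) ≤ 2 * B * (b - a) := by
  refine sub_le_of_absolutelyContinuous_of_ae_hasDerivAt_le
    (φ := fun t => inner ℝ c (x t - q t) - √(quad (Q t) c + ε)) hab ?_ ?_
  · have hinner : AbsolutelyContinuousOnInterval (fun t => inner ℝ c (x t - q t)) a b :=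
      absolutelyContinuousOnInterval_inner (x := fun t => x t - q t) (hx.sub hq) c
    have hsqrt : AbsolutelyContinuousOnInterval (fun t => √(quad (Q t) c + ε)) a b := by
      refine absolutelyContinuousOnInterval_comp_of_lipschitzOnWith (g := fun y => √(y + ε))
        (lipschitzOnWith_sqrt_add hε) (absolutelyContinuousOnInterval_quad hQ c) fun t ht => ?_
      rw [uIcc_of_le hab] at ht
      exact quad_nonneg (hpsd t ht) c
    exact hinner.sub hsqrt
  filter_upwards [hvel, hshape, ae_hasDerivAt_of_absolutelyContinuous hx,
    ae_hasDerivAt_of_absolutelyContinuous hq, ae_hasMatDerivAt hQ]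
    with t hvel hshape hx' hq' hQ' hmem d hd
  have hmem' : t ∈ uIcc a b := uIcc_of_le hab ▸ Ioo_subset_Icc_self hmem
  have hpos : 0 < quad (Q t) c + ε :=
    add_pos_of_nonneg_of_pos (quad_nonneg (hpsd t (Ioo_subset_Icc_self hmem)) c) hε
  have hinner :
      HasDerivAt (fun t => inner ℝ c (x t - q t)) (inner ℝ c (deriv x t - deriv q t)) t := by
    simpa using (hasDerivAt_const t c).inner ℝ ((hx' hmem').sub (hq' hmem'))
  rw [hd.unique (hinner.sub ((((hQ' hmem').quad c).add_const ε).sqrt hpos.ne'))]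
  have hle : inner ℝ c (deriv x t - deriv q t) ≤ B :=
    (real_inner_le_norm _ _).trans
      ((mul_le_of_le_one_left (norm_nonneg _) hc).trans (hvel hmem))
  have hsqrt : 0 < √(quad (Q t) c + ε) := Real.sqrt_pos.2 hpos
  have hsupp : supp (Q t) c * ‖c‖ ≤ √(quad (Q t) c + ε) * 1 :=
    mul_le_mul (Real.sqrt_le_sqrt (by linarith)) hc (norm_nonneg _) hsqrt.le
  have hge : -B ≤ quad (matDeriv Q t) c / (2 * √(quad (Q t) c + ε)) := by
    rw [le_div_iff₀ (by positivity)]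
    nlinarith [hshape hmem]
  linarith

lemma inner_sub_supp_le_add (hab : a ≤ b) (hB : 0 ≤ B)
    (hx : AbsolutelyContinuousOnInterval x a b) (hq : AbsolutelyContinuousOnInterval q a b)
    (hQ : ∀ i j, AbsolutelyContinuousOnInterval (fun t => Q t i j) a b)
    (hpsd : ∀ t ∈ Icc a b, (Q t).PosSemidef) {c : Vec n} (hc : ‖c‖ ≤ 1)
    (hvel : ∀ᵐ t, t ∈ Ioo a b → ‖deriv x t - deriv q t‖ ≤ B)
    (hshape : ∀ᵐ t, t ∈ Ioo a b → -(2 * B * supp (Q t) c * ‖c‖) ≤ quad (matDeriv Q t) c) :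
    inner ℝ c (x b - q b) - supp (Q b) c ≤
      inner ℝ c (x a - q a) - supp (Q a) c + 2 * B * (b - a) := by
  have hlim : ∀ y : ℝ, Tendsto (fun ε => √(y + ε)) (𝓝[>] 0) (𝓝 √y) := fun y => by
    have : Continuous fun ε => √(y + ε) := by fun_prop
    simpa using (this.tendsto 0).mono_left nhdsWithin_le_nhds
  have := le_of_tendsto ((tendsto_const_nhds.sub (hlim (quad (Q b) c))).sub
    (tendsto_const_nhds.sub (hlim (quad (Q a) c))))
    (eventually_nhdsWithin_of_forall fun ε hε =>
      inner_sub_sqrt_le_add hε hab hB hx hq hQ hpsd hc hvel hshape)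
  simp only [supp]
  linarith

lemma antitoneOn_infDist_ellipsoid_sub (hB : 0 ≤ B)
    (hx : AbsolutelyContinuousOnInterval x a b) (hq : AbsolutelyContinuousOnInterval q a b)
    (hQ : ∀ i j, AbsolutelyContinuousOnInterval (fun t => Q t i j) a b)
    (hpsd : ∀ t ∈ Icc a b, (Q t).PosSemidef)
    (hvel : ∀ᵐ t, t ∈ Ioo a b → ‖deriv x t - deriv q t‖ ≤ B)
    (hshape : ∀ᵐ t, t ∈ Ioo a b →
      ∀ c, -(2 * B * supp (Q t) c * ‖c‖) ≤ quad (matDeriv Q t) c) :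
    AntitoneOn (fun t => Metric.infDist (x t) (ellipsoid (q t) (Q t)) - 2 * B * t) (Icc a b) := by
  intro t ht t' ht' htt'
  have hIcc : Icc t t' ⊆ Icc a b := Icc_subset_Icc ht.1 ht'.2
  have hIoo : Ioo t t' ⊆ Ioo a b := Ioo_subset_Ioo ht.1 ht'.2
  have huIcc : uIcc t t' ⊆ uIcc a b := by
    rwa [uIcc_of_le htt', uIcc_of_le (ht.1.trans ht.2)]
  obtain ⟨c, hc, hle⟩ := exists_infDist_ellipsoid_le (hpsd t' ht') (q t') (x t')
  have hgrow := inner_sub_supp_le_add htt' hB (hx.mono huIcc) (hq.mono huIcc)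
    (fun i j => (hQ i j).mono huIcc) (fun s hs => hpsd s (hIcc hs)) hc
    (hvel.mono fun s h hs => h (hIoo hs)) (hshape.mono fun s h hs => h (hIoo hs) c)
  have hge := inner_sub_supp_le_infDist (hpsd t ht) (q := q t) (x := x t) hc
  simp only
  linarith

theorem mem_ellipsoid_of_isTangent {L : ℝ} (hab : a ≤ b) (hB : 0 ≤ B) (hL : 0 ≤ L)
    (hx : AbsolutelyContinuousOnInterval x a b) (hq : AbsolutelyContinuousOnInterval q a b)
    (hQ : ∀ i j, AbsolutelyContinuousOnInterval (fun t => Q t i j) a b)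
    (hpsd : ∀ t ∈ Icc a b, (Q t).PosSemidef)
    (hvel : ∀ᵐ t, t ∈ Ioo a b → ‖deriv x t - deriv q t‖ ≤ B)
    (hboundary : ∀ᵐ t, t ∈ Ioo a b → ∀ z, supp (Q t) z = 1 →
      ∃ T, ‖T‖ ≤ B ∧ IsTangent (Q t) (matDeriv Q t) z T)
    (hnearest : ∀ᵐ t, t ∈ Ioo a b → ∃ z T, supp (Q t) z ≤ 1 ∧
      Metric.infDist (x t) (ellipsoid (q t) (Q t)) = dist (x t) (q t + act (Q t) z) ∧
      IsTangent (Q t) (matDeriv Q t) z T ∧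
      ‖deriv x t - (deriv q t + T)‖ ≤ L * Metric.infDist (x t) (ellipsoid (q t) (Q t)))
    (ha : x a ∈ ellipsoid (q a) (Q a)) : x b ∈ ellipsoid (q b) (Q b) := by
  have hmem' : ∀ t ∈ Ioo a b, t ∈ uIcc a b := fun t ht =>
    Icc_subset_uIcc (Ioo_subset_Icc_self ht)
  rw [(isCompact_ellipsoid _ _).isClosed.mem_iff_infDist_zero ⟨_, center_mem_ellipsoid _ _⟩]
  refine eq_zero_of_antitoneOn_sub_of_ae_deriv_le
    (D := fun t => Metric.infDist (x t) (ellipsoid (q t) (Q t))) hab hL (by positivity)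
    (fun t => Metric.infDist_nonneg)
    (antitoneOn_infDist_ellipsoid_sub hB hx hq hQ hpsd hvel ?_) ?_ (Metric.infDist_zero_of_mem ha)
  · filter_upwards [hboundary, ae_quad_matDeriv_eq_zero hQ hpsd] with t hb hker hmem
    exact neg_le_quad_of_isTangent (hpsd t (Ioo_subset_Icc_self hmem)) (hker hmem) (hb hmem)
  · filter_upwards [hnearest, ae_hasMatDerivAt hQ, ae_hasDerivAt_of_absolutelyContinuous hx,
      ae_hasDerivAt_of_absolutelyContinuous hq] with t hnear hQ' hx' hq' hmem d hd
    obtain ⟨z, T, hz, hdist, hT, hle⟩ := hnear hmem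
    have hev : ∀ᶠ s in 𝓝 t, (Q s).PosSemidef := by
      filter_upwards [Icc_mem_nhds hmem.1 hmem.2] with s hs using hpsd s hs
    exact (hT.deriv_infDist_le (hx' (hmem' t hmem)) (hq' (hmem' t hmem)) (hQ' (hmem' t hmem)) hev
      hz hdist hd).trans hle

end Distance

end MovingEllipsoid

/-! ### Viable controls -/

section LinearAlgebra

variable {n : ℕ} {Q Q' F P₁ P₂ : Mat n n} {lam kap : ℝ} {z e : Vec n}

lemma act_eq_zero_of_quad (hQ : Q.PosSemidef) {c : Vec n} (h : quad Q c = 0) : act Q c = 0 :=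
  act_eq_zero_of_supp hQ (by rw [supp, h, Real.sqrt_zero])

lemma two_mul_le_inv_add_mul_sq (a : ℝ) {l : ℝ} (hl : 0 < l) : 2 * a ≤ 1 / l + l * a ^ 2 := by
  have h : 1 / l + l * a ^ 2 - 2 * a = (l * a - 1) ^ 2 / l := by
    field_simp
    ring
  linarith [div_nonneg (sq_nonneg (l * a - 1)) hl.le]

lemma quad_add_transpose (F : Mat n n) (c : Vec n) :
    quad (F + Fᵀ) c = 2 * inner ℝ c (act F c) := by
  rw [quad, add_act, inner_add_right, inner_act Fᵀ, Matrix.transpose_transpose, real_inner_comm,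
    ← two_mul, real_inner_comm]

lemma add_le_quad_of_loewner
    (h : Loewner (F + Fᵀ + (1 / lam + 1 / kap) • Q + lam • P₁ + kap • P₂) Q') (c : Vec n) :
    2 * inner ℝ c (act F c) + (1 / lam + 1 / kap) * quad Q c + lam * quad P₁ c + kap * quad P₂ c ≤
      quad Q' c := by
  refine le_of_eq_of_le ?_ (quad_le_of_loewner h c)
  rw [← quad_add_transpose]
  simp only [quad, add_act, smul_act, inner_add_right, inner_smul_right]

lemma loewner_add_transpose (hQ : Q.PosSemidef) (hP₁ : P₁.PosSemidef) (hP₂ : P₂.PosSemidef)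
    (hlam : 0 < lam) (hkap : 0 < kap)
    (h : Loewner (F + Fᵀ + (1 / lam + 1 / kap) • Q + lam • P₁ + kap • P₂) Q') :
    Loewner (F + Fᵀ) Q' := by
  have hrest := ((hQ.smul (by positivity : 0 ≤ 1 / lam + 1 / kap)).add (hP₁.smul hlam.le)).add
    (hP₂.smul hkap.le)
  refine (congrArg Matrix.PosSemidef ?_).mp (h.add hrest)
  abel

lemma inner_act_eq_of_loewner (hF : ∀ c, act Q c = 0 → act F c = 0)
    (hQ' : ∀ c, act Q c = 0 → quad Q' c = 0) (h : Loewner (F + Fᵀ) Q') {c : Vec n}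
    (hc : act Q c = 0) : inner ℝ c (act Q' z) = inner ℝ c (act F z) := by
  have hzero : quad (Q' - (F + Fᵀ)) c = 0 := by
    rw [quad, sub_act, inner_sub_right, ← quad, ← quad, hQ' c hc, quad_add_transpose, hF c hc,
      inner_zero_right, mul_zero, sub_zero]
  have hker : inner ℝ c (act (Q' - (F + Fᵀ)) z) = 0 := by
    rw [inner_act_comm h, act_eq_zero_of_quad h hzero, inner_zero_right]
  have hFz : inner ℝ c (act Fᵀ z) = 0 := by
    rw [inner_act, Matrix.transpose_transpose, hF c hc, inner_zero_left]
  rw [sub_act, add_act, inner_sub_right, inner_add_right, hFz] at hker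
  linarith

lemma inner_eq_zero_of_loewner (hP₁ : P₁.PosSemidef) (hP₂ : P₂.PosSemidef) (hlam : 0 < lam)
    (hkap : 0 < kap) (hF : ∀ c, act Q c = 0 → act F c = 0)
    (hQ' : ∀ c, act Q c = 0 → quad Q' c = 0)
    (h : Loewner (F + Fᵀ + (1 / lam + 1 / kap) • Q + lam • P₁ + kap • P₂) Q')
    (he : ∀ c, inner ℝ c e ≤ supp P₁ c + supp P₂ c) {c : Vec n} (hc : act Q c = 0) :
    inner ℝ c e = 0 := by
  have hle : ∀ c, act Q c = 0 → inner ℝ c e ≤ 0 := fun c hc => by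
    have hquad := add_le_quad_of_loewner h c
    rw [hQ' c hc, hF c hc, quad, hc, inner_zero_right, mul_zero, mul_zero, zero_add, zero_add]
      at hquad
    have h₁ := mul_nonneg hlam.le (quad_nonneg hP₁ c)
    have h₂ := mul_nonneg hkap.le (quad_nonneg hP₂ c)
    have hP₁c : quad P₁ c = 0 := (mul_eq_zero_iff_left hlam.ne').1 (by linarith)
    have hP₂c : quad P₂ c = 0 := (mul_eq_zero_iff_left hkap.ne').1 (by linarith)
    simpa [supp, hP₁c, hP₂c] using he c
  have hneg := hle (-c) (by simp [hc])
  rw [inner_neg_left] at hneg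
  linarith [hle c hc]

/-- On the boundary the terms with `1 / lam + 1 / kap` pay for the perturbation `e` by the
inequality of arithmetic and geometric means; on the kernel of `Q` every term has to vanish. -/
lemma isTangent_of_loewner (hQ : Q.PosSemidef) (hP₁ : P₁.PosSemidef) (hP₂ : P₂.PosSemidef)
    (hlam : 0 < lam) (hkap : 0 < kap) (hF : ∀ c, act Q c = 0 → act F c = 0)
    (hQ' : ∀ c, act Q c = 0 → quad Q' c = 0)
    (h : Loewner (F + Fᵀ + (1 / lam + 1 / kap) • Q + lam • P₁ + kap • P₂) Q')
    (he : ∀ c, inner ℝ c e ≤ supp P₁ c + supp P₂ c) : IsTangent Q Q' z (act F z + e) where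
  range := by
    refine exists_act_eq_of_orthogonal_ker hQ fun c hc => ?_
    rw [inner_sub_right, inner_add_right, inner_eq_zero_of_loewner hP₁ hP₂ hlam hkap hF hQ' h he hc,
      inner_act_eq_of_loewner hF hQ' (loewner_add_transpose hQ hP₁ hP₂ hlam hkap h) hc, add_zero,
      sub_self]
  inward hz := by
    have hquad := add_le_quad_of_loewner h z
    rw [← supp_sq hQ, ← supp_sq hP₁, ← supp_sq hP₂, hz, one_pow, mul_one] at hquad
    rw [inner_add_right]
    linarith [he z, two_mul_le_inv_add_mul_sq (supp P₁ z) hlam,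
      two_mul_le_inv_add_mul_sq (supp P₂ z) hkap]

end LinearAlgebra

section Gain

variable {nx nu : ℕ}

/-- The gain `R^{1/2} Sᵀ Q^{1/2}`: at the point `q + Q z` of the tube the control is the nominal
control plus this matrix applied to `z`. -/
def gain (Q : Mat nx nx) (S : Mat nx nu) (R : Mat nu nu) : Mat nu nx := msqrt R * Sᵀ * msqrt Q

lemma gain_transpose (Q : Mat nx nx) (S : Mat nx nu) (R : Mat nu nu) :
    (gain Q S R)ᵀ = msqrt Q * S * msqrt R := by
  simp only [gain, Matrix.transpose_mul, Matrix.transpose_transpose,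
    transpose_eq (msqrt_posSemidef _), Matrix.mul_assoc]

lemma act_gain_eq_zero {Q : Mat nx nx} (hQ : Q.PosSemidef) (S : Mat nx nu) (R : Mat nu nu)
    {c : Vec nx} (hc : act Q c = 0) : act (gain Q S R) c = 0 := by
  rw [gain, mul_act, act_msqrt_eq_zero hQ hc, act_zero]

lemma controlTerm_eq (Q : Mat nx nx) (S : Mat nx nu) (R : Mat nu nu) (G₀ : Mat nx nu) :
    controlTerm Q S R G₀ = G₀ * gain Q S R + (G₀ * gain Q S R)ᵀ := by
  rw [Matrix.transpose_mul, gain_transpose, add_comm, controlTerm, gain]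
  simp only [Matrix.mul_assoc]

lemma norm_act_transpose_le {S : Mat nx nu} (hS : Loewner (S * Sᵀ) 1) (v : Vec nx) :
    ‖act Sᵀ v‖ ≤ ‖v‖ := by
  have h := quad_le_of_loewner hS v
  rw [quad, quad, mul_act, inner_act, one_act, real_inner_self_eq_norm_sq,
    real_inner_self_eq_norm_sq] at h
  exact le_of_sq_le_sq h (norm_nonneg _)

lemma add_act_gain_mem_ellipsoid {Q : Mat nx nx} (hQ : Q.PosSemidef) {S : Mat nx nu}
    (hS : Loewner (S * Sᵀ) 1) (R : Mat nu nu) (u : Vec nu) {z : Vec nx} (hz : supp Q z ≤ 1) :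
    u + act (gain Q S R) z ∈ ellipsoid u R := by
  refine ⟨act Sᵀ (act (msqrt Q) z), (norm_act_transpose_le hS _).trans ?_, ?_⟩
  · rwa [← supp_eq_norm hQ]
  · rw [gain, mul_act, mul_act]

lemma quad_innerShape (qu : Vec nu) (Qu : Mat nu nu) (γ : ℝ) (u e : Vec nu) :
    quad (innerShape qu Qu γ u) e =
      (1 - γ) * quad Qu e + (1 - γ⁻¹) * (inner ℝ e (u - qu)) ^ 2 := by
  rw [innerShape, quad, add_act, smul_act, smul_act, inner_add_right, inner_smul_right,
    inner_smul_right, inner_vecMulVec_act, quad]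

lemma supp_innerShape_le {qu : Vec nu} {Qu : Mat nu nu} (hQu : Qu.PosSemidef) {γ : ℝ} (hγ : 0 < γ)
    (hγ' : γ ≤ 1) (u e : Vec nu) : supp (innerShape qu Qu γ u) e ≤ supp Qu e := by
  refine Real.sqrt_le_sqrt ?_
  rw [quad_innerShape]
  have h1 : 1 ≤ γ⁻¹ := (one_le_inv₀ hγ).2 hγ'
  nlinarith [quad_nonneg hQu e, sq_nonneg (inner ℝ e (u - qu) : ℝ)]

/-- With `a` the left inner product and `r`, `s` the support functions, one has
`γ (1 - γ) (s² - (a + r)²) = (γ r - (1 - γ) a)²`. -/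
lemma inner_add_supp_innerShape_le {qu : Vec nu} {Qu : Mat nu nu} (hQu : Qu.PosSemidef) {γ : ℝ}
    (hγ : 0 < γ) (hγ' : γ ≤ 1) {u : Vec nu} (hu : u ∈ ellipsoid qu Qu)
    (hR : (innerShape qu Qu γ u).PosSemidef) (e : Vec nu) :
    inner ℝ e (u - qu) + supp (innerShape qu Qu γ u) e ≤ supp Qu e := by
  have hr := supp_sq hR e
  rw [quad_innerShape, ← supp_sq hQu e] at hr
  have hle := inner_sub_le_supp hQu hu e
  have hs0 := supp_nonneg Qu e
  set r := supp (innerShape qu Qu γ u) e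
  set s := supp Qu e
  set a : ℝ := inner ℝ e (u - qu)
  rcases hγ'.eq_or_lt with rfl | hlt
  · have : r = 0 := by simpa using hr
    linarith
  have hid : γ * (1 - γ) * (s ^ 2 - (a + r) ^ 2) = (γ * r - (1 - γ) * a) ^ 2 := by
    have : γ * r ^ 2 = (1 - γ) * (γ * s ^ 2 - a ^ 2) := by
      rw [hr]
      field_simp
      ring
    linear_combination -this
  have hpos : 0 < γ * (1 - γ) := mul_pos hγ (sub_pos.2 hlt)
  have hsq : (a + r) ^ 2 ≤ s ^ 2 :=
    sub_nonneg.1 (nonneg_of_mul_nonneg_right (hid ▸ sq_nonneg _) hpos)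
  exact (abs_le_of_sq_le_sq' hsq hs0).2

lemma ellipsoid_innerShape_subset {qu : Vec nu} {Qu : Mat nu nu} (hQu : Qu.PosSemidef) {γ : ℝ}
    (hγ : 0 < γ) (hγ' : γ ≤ 1) {u ubar : Vec nu} (hu : u ∈ ellipsoid qu Qu)
    (hR : (innerShape qu Qu γ u).PosSemidef) (hubar : ubar = u ∨ ubar = qu) :
    ellipsoid ubar (innerShape qu Qu γ u) ⊆ ellipsoid qu Qu := by
  refine fun y hy => mem_ellipsoid_of_forall_inner_le hQu fun c => ?_
  have hle := inner_sub_le_supp hR hy c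
  rcases hubar with rfl | rfl
  · rw [← sub_add_sub_cancel y ubar qu, inner_add_right]
    linarith [inner_add_supp_innerShape_le hQu hγ hγ' hu hR c]
  · exact hle.trans (supp_innerShape_le hQu hγ hγ' u c)

end Gain

section ViableControl

variable {nx nu nw : ℕ} {f : Vec nx → Vec nw → Vec nx} {G : Vec nx → Mat nx nu} {qw : Vec nw}
  {Qw : Mat nw nw} {Ωn : Vec nx → Mat nx nx → Mat nx nx}
  {ΩG : Vec nx → Mat nx nx → Mat nu nu → Mat nx nu → Mat nx nx} {u ubar : Vec nu}
  {q z : Vec nx} {Q Q' : Mat nx nx} {S : Mat nx nu} {R : Mat nu nu} {lam kap : ℝ}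

lemma rhs_add_eq (f : Vec nx → Vec nw → Vec nx) (G : Vec nx → Mat nx nu) (qw : Vec nw)
    (q : Vec nx) (u ubar : Vec nu) (ξ : Vec nx) (ν : Vec nu) (w : Vec nw) :
    rhs f G (q + ξ) (ubar + ν) w = rhs f G q u qw + (act (Amat f G qw q u) ξ + act (G (q + ξ)) ν +
      (act (Bmat f qw q) (w - qw) + remainder f G qw q u ubar ξ (w - qw) 0)) := by
  simp only [remainder, rhs, act_zero, act_add, add_zero, add_sub_cancel]
  abel

lemma quad_mul_mul_transpose {m n : ℕ} (B : Mat m n) (P : Mat n n) (c : Vec m) :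
    quad (B * P * Bᵀ) c = quad P (act Bᵀ c) := by
  rw [quad, mul_act, mul_act, inner_act B, quad]

lemma inner_perturbation_le (hQw : Qw.PosSemidef) (hΩn : (Ωn q Q).PosSemidef) {ξ : Vec nx}
    {w : Vec nw} (hw : w ∈ ellipsoid qw Qw)
    (hn : remainder f G qw q u ubar ξ (w - qw) 0 ∈ ellipsoid 0 (Ωn q Q)) (c : Vec nx) :
    inner ℝ c (act (Bmat f qw q) (w - qw) + remainder f G qw q u ubar ξ (w - qw) 0) ≤
      supp (Bmat f qw q * Qw * (Bmat f qw q)ᵀ) c + supp (Ωn q Q) c := by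
  rw [inner_add_right, inner_act, supp, quad_mul_mul_transpose, ← supp]
  gcongr
  · exact inner_sub_le_supp hQw hw _
  · simpa using inner_sub_le_supp hΩn hn c

lemma loewner_closedLoop (hQ : Q.PosSemidef) {G₀ : Mat nx nu}
    (hΩG : Loewner (controlTerm Q S R G₀ - controlTerm Q S R (G q)) (ΩG q Q R S))
    (hineq : Loewner (Phi f G qw Qw Ωn ΩG u q Q S R lam kap) Q') :
    Loewner ((Amat f G qw q u * Q + G₀ * gain Q S R) +
        (Amat f G qw q u * Q + G₀ * gain Q S R)ᵀ + (1 / lam + 1 / kap) • Q +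
        lam • (Bmat f qw q * Qw * (Bmat f qw q)ᵀ) + kap • Ωn q Q) Q' := by
  refine (congrArg Matrix.PosSemidef ?_).mp (hineq.add hΩG)
  rw [Phi, controlTerm_eq Q S R G₀, Matrix.transpose_add, Matrix.transpose_mul (Amat f G qw q u),
    transpose_eq hQ]
  abel

/-- The control `u` moves the point `q + Q z` of an ellipsoid with shape matrix `Q`, whose centre
and shape matrix have velocities `v` and `Q'`, along a tangent vector, whatever the disturbance
in `W`. -/
def IsViableControl (f : Vec nx → Vec nw → Vec nx) (G : Vec nx → Mat nx nu) (W : Set (Vec nw))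
    (q : Vec nx) (Q Q' : Mat nx nx) (v z : Vec nx) (u : Vec nu) : Prop :=
  ∀ w ∈ W, IsTangent Q Q' z (rhs f G (q + act Q z) u w - v)

lemma isViableControl_gain (hQ : Q.PosSemidef) (hQw : Qw.PosSemidef) (hΩn : (Ωn q Q).PosSemidef)
    (hn : ∀ ξ ∈ ellipsoid 0 Q, ∀ ω ∈ ellipsoid 0 Qw,
      remainder f G qw q u ubar ξ ω 0 ∈ ellipsoid 0 (Ωn q Q))
    (hΩG : ∀ p ∈ ellipsoid q Q,
      Loewner (controlTerm Q S R (G p) - controlTerm Q S R (G q)) (ΩG q Q R S))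
    (hlam : 0 < lam) (hkap : 0 < kap)
    (hineq : Loewner (Phi f G qw Qw Ωn ΩG u q Q S R lam kap) Q')
    (hQ' : ∀ c, act Q c = 0 → quad Q' c = 0) (hz : supp Q z ≤ 1) :
    IsViableControl f G (ellipsoid qw Qw) q Q Q' (rhs f G q u qw) z
      (ubar + act (gain Q S R) z) := by
  intro w hw
  have hp : q + act Q z ∈ ellipsoid q Q := (mem_ellipsoid_iff hQ).2 ⟨z, hz, rfl⟩
  have hrem := hn _ (add_mem_ellipsoid_iff.1 hp) (w - qw)
    (add_mem_ellipsoid_iff.1 (by rwa [add_sub_cancel]))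
  have hB : (Bmat f qw q * Qw * (Bmat f qw q)ᵀ).PosSemidef := by
    simpa [Matrix.conjTranspose_eq_transpose_of_trivial] using
      hQw.mul_mul_conjTranspose_same (Bmat f qw q)
  rw [rhs_add_eq f G qw q u, add_sub_cancel_left, ← mul_act, ← mul_act, ← add_act]
  refine isTangent_of_loewner hQ hB hΩn hlam hkap (fun c hc => ?_) hQ'
    (loewner_closedLoop hQ (hΩG _ hp) hineq) (inner_perturbation_le hQw hΩn hw hrem)
  rw [add_act, mul_act, mul_act, hc, act_gain_eq_zero hQ S R hc, act_zero, act_zero, add_zero]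

end ViableControl

/-! ### The feedback law -/

section Measurability

variable {X : Type*} [MeasurableSpace X] {m n : ℕ}

lemma measurable_vec {φ : X → Vec n} (h : ∀ i, Measurable fun x => φ x i) : Measurable φ :=
  (PiLp.continuous_toLp 2 fun _ : Fin n => ℝ).measurable.comp
    (measurable_pi_lambda (fun x => (φ x).ofLp) h)

lemma measurable_act {M : X → Mat m n} (hM : ∀ i j, Measurable fun x => M x i j) {z : X → Vec n}
    (hz : Measurable z) : Measurable fun x => act (M x) (z x) := by
  refine measurable_vec fun i => ?_
  simp only [act_apply]
  exact Finset.measurable_fun_sum _ fun j _ =>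
    (hM i j).mul ((EuclideanSpace.proj (𝕜 := ℝ) j).continuous.measurable.comp hz)

lemma measurable_quad {M : X → Mat n n} (hM : ∀ i j, Measurable fun x => M x i j) {z : X → Vec n}
    (hz : Measurable z) : Measurable fun x => quad (M x) (z x) :=
  hz.inner (measurable_act hM hz)

lemma measurable_supp {M : X → Mat n n} (hM : ∀ i j, Measurable fun x => M x i j) {z : X → Vec n}
    (hz : Measurable z) : Measurable fun x => supp (M x) (z x) :=
  (measurable_quad hM hz).sqrt

lemma convex_setOf_supp_le_one {Q : Mat n n} (hQ : Q.PosSemidef) :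
    Convex ℝ {z | supp Q z ≤ 1} := by
  have : {z | supp Q z ≤ 1} = Matrix.toEuclideanLin (msqrt Q) ⁻¹' Metric.closedBall 0 1 := by
    ext z
    simp [supp_eq_norm hQ, act]
  exact this ▸ (convex_closedBall _ _).linear_preimage _

lemma convex_setOf_dist_add_act_le (Q : Mat n n) (ξ q : Vec n) (r : ℝ) :
    Convex ℝ {z | dist ξ (q + act Q z) ≤ r} := by
  have : {z | dist ξ (q + act Q z) ≤ r} =
      Matrix.toEuclideanLin Q ⁻¹' Metric.closedBall (ξ - q) r := by
    ext z
    simp [dist_comm, dist_eq_norm, act, sub_add_eq_sub_sub]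
  exact this ▸ (convex_closedBall _ _).linear_preimage _

/-- The normal cone description of the nearest point is measurable in the data and the metric one is
convex in `z`. -/
lemma exists_measurable_nearest {ξ q : X → Vec n} {Q : X → Mat n n} (hξ : Measurable ξ)
    (hq : Measurable q) (hQm : ∀ i j, Measurable fun x => Q x i j)
    (hQ : ∀ x, (Q x).PosSemidef) :
    ∃ z : X → Vec n, Measurable z ∧ ∀ x, supp (Q x) (z x) ≤ 1 ∧
      Metric.infDist (ξ x) (ellipsoid (q x) (Q x)) = dist (ξ x) (q x + act (Q x) (z x)) := by
  set y : X → Vec n → Vec n := fun x z => ξ x - (q x + act (Q x) z)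
  set h : Unit → X → Vec n → ℝ := fun _ x z =>
    max (supp (Q x) z - 1) (supp (Q x) (y x z) - inner ℝ (y x z) (act (Q x) z))
  have hiff : ∀ x z, h () x z ≤ 0 ↔ supp (Q x) z ≤ 1 ∧
      Metric.infDist (ξ x) (ellipsoid (q x) (Q x)) = dist (ξ x) (q x + act (Q x) z) := by
    intro x z
    rw [max_le_iff, sub_nonpos, sub_nonpos]
    refine and_congr_right fun hz => ?_
    rw [infDist_ellipsoid_eq_dist_iff (hQ x) ((mem_ellipsoid_iff (hQ x)).2 ⟨z, hz, rfl⟩),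
      add_sub_cancel_left]
  have hle : ∀ x z, h () x z ≤ 0 ↔ supp (Q x) z ≤ 1 ∧
      dist (ξ x) (q x + act (Q x) z) ≤ Metric.infDist (ξ x) (ellipsoid (q x) (Q x)) := by
    intro x z
    rw [hiff]
    refine and_congr_right fun hz => ⟨fun h => h.ge, fun h => h.antisymm' ?_⟩
    exact Metric.infDist_le_dist_of_mem ((mem_ellipsoid_iff (hQ x)).2 ⟨z, hz, rfl⟩)
  obtain ⟨z, hz, hsel⟩ := exists_measurable_selection (h := h)
    (fun _ z => by
      have hy : Measurable fun x => y x z :=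
        hξ.sub (hq.add (measurable_act hQm measurable_const))
      exact ((measurable_supp hQm measurable_const).sub_const 1).max
        ((measurable_supp hQm hy).sub (hy.inner (measurable_act hQm measurable_const))))
    (fun _ x => by
      have hy : Continuous (y x) := continuous_const.sub (continuous_const.add (continuous_act _))
      exact ((continuous_supp _).sub continuous_const).max
        (((continuous_supp _).comp hy).sub (hy.inner (continuous_act _))))
    (fun x z => continuous_const)
    (fun _ x => by
      simp only [hle]
      exact (convex_setOf_supp_le_one (hQ x)).inter (convex_setOf_dist_add_act_le _ _ _ _))
    (fun x => by
      obtain ⟨p, hp, hdist⟩ := exists_infDist_ellipsoid_eq_dist (q x) (ξ x) (Q x)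
      obtain ⟨z, hz, rfl⟩ := (mem_ellipsoid_iff (hQ x)).1 hp
      exact ⟨z, fun _ => (hiff x z).2 ⟨hz, hdist⟩⟩)
  exact ⟨z, hz, fun x => (hiff x (z x)).1 (hsel () x)⟩

end Measurability

section Feedback

variable {nx nu nw : ℕ} {f : Vec nx → Vec nw → Vec nx} {G : Vec nx → Mat nx nu}

section Selection

variable {X : Type*} [MeasurableSpace X] {V : Set (Vec nu)} {W : Set (Vec nw)}

lemma rhs_sub_rhs (f : Vec nx → Vec nw → Vec nx) (G : Vec nx → Mat nx nu) (p : Vec nx)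
    (u : Vec nu) (w w₀ : Vec nw) : rhs f G p u w - rhs f G p u w₀ = f p w - f p w₀ := by
  simp only [rhs, add_sub_add_right_eq_sub]

/-- The difference of the velocities for two disturbances does not depend on the control. -/
lemma IsViableControl.of_inward {q v z : Vec nx} {Q Q' : Mat nx nx} {u u' : Vec nu} {w₀ : Vec nw}
    (hu' : IsViableControl f G W q Q Q' v z u') (hw₀ : w₀ ∈ W)
    (hrange : ∃ ζ, act Q ζ = rhs f G (q + act Q z) u w₀ - v - act Q' z)
    (hinward : ∀ w ∈ W, supp Q z = 1 →
      2 * inner ℝ z (rhs f G (q + act Q z) u w - v) ≤ quad Q' z) :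
    IsViableControl f G W q Q Q' v z u := by
  refine fun w hw => ⟨?_, hinward w hw⟩
  obtain ⟨ζ, hζ⟩ := hrange
  obtain ⟨ζ₁, hζ₁⟩ := (hu' w hw).range
  obtain ⟨ζ₀, hζ₀⟩ := (hu' w₀ hw₀).range
  refine ⟨ζ + (ζ₁ - ζ₀), ?_⟩
  have hdiff := rhs_sub_rhs f G (q + act Q z) u w w₀
  rw [← rhs_sub_rhs f G (q + act Q z) u' w w₀] at hdiff
  rw [act_add, act_sub, hζ, hζ₁, hζ₀, sub_sub_sub_cancel_right, sub_sub_sub_cancel_right, ← hdiff]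
  abel

lemma measurable_rhs (hf : Continuous fun a : Vec nx × Vec nw => f a.1 a.2)
    (hG : ∀ i j, Continuous fun x => G x i j) {p : X → Vec nx} (hp : Measurable p) (u : Vec nu)
    (w : Vec nw) : Measurable fun x => rhs f G (p x) u w :=
  (hf.measurable.comp (hp.prodMk measurable_const)).add
    (measurable_act (fun i j => (hG i j).measurable.comp hp) measurable_const)

lemma rhs_convexCombination (f : Vec nx → Vec nw → Vec nx) (G : Vec nx → Mat nx nu) (p : Vec nx)
    (u u' : Vec nu) (w : Vec nw) {a b : ℝ} (hab : a + b = 1) :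
    rhs f G p (a • u + b • u') w = a • rhs f G p u w + b • rhs f G p u' w := by
  simp only [rhs, act_add, act_smul, smul_add]
  rw [add_add_add_comm, ← add_smul, hab, one_smul]

/-- The pairs of a control and of a witness of the range condition which keep the point `q + Q z`
viable against the disturbance `w`. Unlike the set of viable controls, it is cut out by constraints
that are measurable in the data: the range of a matrix does not depend continuously on the
matrix. -/
def viablePairs (f : Vec nx → Vec nw → Vec nx) (G : Vec nx → Mat nx nu) (V : Set (Vec nu))
    (w₀ w : Vec nw) (q : Vec nx) (Q Q' : Mat nx nx) (v z : Vec nx) : Set (Vec nu × Vec nx) :=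
  {e | e.1 ∈ V ∧ act Q e.2 = rhs f G (q + act Q z) e.1 w₀ - v - act Q' z ∧
    (supp Q z = 1 → 2 * inner ℝ z (rhs f G (q + act Q z) e.1 w - v) ≤ quad Q' z)}

lemma convex_viablePairs (hV : Convex ℝ V) (w₀ w : Vec nw) (q : Vec nx) (Q Q' : Mat nx nx)
    (v z : Vec nx) : Convex ℝ (viablePairs f G V w₀ w q Q Q' v z) := by
  rintro ⟨u, ζ⟩ ⟨hu, hζ, hin⟩ ⟨u', ζ'⟩ ⟨hu', hζ', hin'⟩ a b ha hb hab
  have hvel : ∀ w, rhs f G (q + act Q z) (a • u + b • u') w - v =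
      a • (rhs f G (q + act Q z) u w - v) + b • (rhs f G (q + act Q z) u' w - v) := fun w => by
    rw [rhs_convexCombination f G _ u u' w hab, smul_sub, smul_sub, sub_add_sub_comm, ← add_smul,
      hab, one_smul]
  refine ⟨hV hu hu' ha hb hab, ?_, fun h => ?_⟩
  · simp only [Prod.fst_add, Prod.snd_add, Prod.smul_fst, Prod.smul_snd, act_add, act_smul, hvel]
      at hζ hζ' ⊢
    rw [hζ, hζ', smul_sub a _ (act Q' z), smul_sub b _ (act Q' z), sub_add_sub_comm, ← add_smul,
      hab, one_smul]
  · simp only [Prod.fst_add, Prod.smul_fst, hvel, inner_add_right, inner_smul_right] at hin hin' ⊢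
    linear_combination a * hin h + b * hin' h + quad Q' z * hab

/-- `viablePairs` as a sublevel set, for the sake of measurable selection. -/
def viabilityDefect (f : Vec nx → Vec nw → Vec nx) (G : Vec nx → Mat nx nu) (V : Set (Vec nu))
    (w₀ w : Vec nw) (q : Vec nx) (Q Q' : Mat nx nx) (v z : Vec nx) (e : Vec nu × Vec nx) : ℝ :=
  open Classical in
  max (Metric.infDist e.1 V)
    (max ‖act Q e.2 - (rhs f G (q + act Q z) e.1 w₀ - v - act Q' z)‖
      (if supp Q z = 1 then 2 * inner ℝ z (rhs f G (q + act Q z) e.1 w - v) - quad Q' z else 0))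

lemma viabilityDefect_le_zero_iff (hVcl : IsClosed V) (hV : V.Nonempty) {w₀ w : Vec nw}
    {q : Vec nx} {Q Q' : Mat nx nx} {v z : Vec nx} {e : Vec nu × Vec nx} :
    viabilityDefect f G V w₀ w q Q Q' v z e ≤ 0 ↔ e ∈ viablePairs f G V w₀ w q Q Q' v z := by
  rw [viabilityDefect, max_le_iff, max_le_iff, norm_le_zero_iff, sub_eq_zero,
    Metric.infDist_nonneg.ge_iff_eq', ← hVcl.mem_iff_infDist_zero hV]
  refine and_congr_right fun _ => and_congr_right fun _ => ?_
  split_ifs with h <;> simp [h]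

lemma continuous_rhs (hf : Continuous fun a : Vec nx × Vec nw => f a.1 a.2) (p : Vec nx) :
    Continuous fun a : Vec nu × Vec nw => rhs f G p a.1 a.2 :=
  (hf.comp (continuous_const.prodMk continuous_snd)).add ((continuous_act _).comp continuous_fst)

lemma continuous_viabilityDefect (hf : Continuous fun a : Vec nx × Vec nw => f a.1 a.2)
    (w₀ : Vec nw) (q : Vec nx) (Q Q' : Mat nx nx) (v z : Vec nx) :
    Continuous fun a : Vec nw × (Vec nu × Vec nx) =>
      viabilityDefect f G V w₀ a.1 q Q Q' v z a.2 := by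
  have hrhs := continuous_rhs (G := G) hf (q + act Q z)
  have h₀ : Continuous fun a : Vec nw × (Vec nu × Vec nx) => rhs f G (q + act Q z) a.2.1 w₀ :=
    hrhs.comp (continuous_snd.fst.prodMk continuous_const)
  have h₁ : Continuous fun a : Vec nw × (Vec nu × Vec nx) => rhs f G (q + act Q z) a.2.1 a.1 :=
    hrhs.comp (continuous_snd.fst.prodMk continuous_fst)
  refine ((Metric.continuous_infDist_pt V).comp continuous_snd.fst).max (Continuous.max ?_ ?_)
  · exact (((continuous_act Q).comp continuous_snd.snd).sub
      ((h₀.sub continuous_const).sub continuous_const)).norm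
  · split_ifs
    · exact (continuous_const.mul (continuous_const.inner (h₁.sub continuous_const))).sub
        continuous_const
    · exact continuous_const

lemma measurable_viabilityDefect (hf : Continuous fun a : Vec nx × Vec nw => f a.1 a.2)
    (hG : ∀ i j, Continuous fun x => G x i j) (w₀ w : Vec nw) {q v z : X → Vec nx}
    {Q Q' : X → Mat nx nx} (hq : Measurable q) (hv : Measurable v) (hz : Measurable z)
    (hQ : ∀ i j, Measurable fun x => Q x i j) (hQ' : ∀ i j, Measurable fun x => Q' x i j)
    (e : Vec nu × Vec nx) :
    Measurable fun x => viabilityDefect f G V w₀ w (q x) (Q x) (Q' x) (v x) (z x) e := by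
  have hvel : ∀ w, Measurable fun x => rhs f G (q x + act (Q x) (z x)) e.1 w - v x := fun w =>
    (measurable_rhs hf hG (hq.add (measurable_act hQ hz)) e.1 w).sub hv
  refine measurable_const.max (Measurable.max ?_ (Measurable.ite ?_ ?_ measurable_const))
  · exact ((measurable_act hQ measurable_const).sub
      ((hvel w₀).sub (measurable_act hQ' hz))).norm
  · exact measurableSet_eq_fun (measurable_supp hQ hz) measurable_const
  · exact (measurable_const.mul (hz.inner (hvel w))).sub (measurable_quad hQ' hz)

lemma exists_measurable_viableControl (hf : Continuous fun a : Vec nx × Vec nw => f a.1 a.2)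
    (hG : ∀ i j, Continuous fun x => G x i j) (hVconv : Convex ℝ V) (hVcl : IsClosed V)
    (hV : V.Nonempty) (hW : W.Nonempty) {q v z : X → Vec nx} {Q Q' : X → Mat nx nx}
    (hq : Measurable q) (hv : Measurable v) (hz : Measurable z)
    (hQ : ∀ i j, Measurable fun x => Q x i j) (hQ' : ∀ i j, Measurable fun x => Q' x i j)
    (hex : ∀ x, ∃ u ∈ V, IsViableControl f G W (q x) (Q x) (Q' x) (v x) (z x) u) :
    ∃ μ : X → Vec nu, Measurable μ ∧
      ∀ x, μ x ∈ V ∧ IsViableControl f G W (q x) (Q x) (Q' x) (v x) (z x) (μ x) := by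
  obtain ⟨w₀, hw₀⟩ := hW
  have : Nonempty W := ⟨⟨w₀, hw₀⟩⟩
  have hcont := fun x => continuous_viabilityDefect (G := G) (V := V) hf w₀ (q x) (Q x) (Q' x)
    (v x) (z x)
  have hex' : ∀ x, ∃ e, ∀ w : W,
      viabilityDefect f G V w₀ w (q x) (Q x) (Q' x) (v x) (z x) e ≤ 0 := fun x => by
    obtain ⟨u, huV, hu⟩ := hex x
    obtain ⟨ζ, hζ⟩ := (hu w₀ hw₀).range
    exact ⟨(u, ζ), fun w => (viabilityDefect_le_zero_iff hVcl hV).2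
      ⟨huV, hζ, (hu w w.2).inward⟩⟩
  have hconv : ∀ (w : W) x,
      Convex ℝ {e | viabilityDefect f G V w₀ w (q x) (Q x) (Q' x) (v x) (z x) e ≤ 0} :=
    fun w x => by
      simp only [viabilityDefect_le_zero_iff hVcl hV]
      exact convex_viablePairs hVconv _ _ _ _ _ _ _
  obtain ⟨e, he, hsel⟩ : ∃ e : X → Vec nu × Vec nx, Measurable e ∧ ∀ (w : W) x,
      viabilityDefect f G V w₀ w (q x) (Q x) (Q' x) (v x) (z x) (e x) ≤ 0 :=
    exists_measurable_selection
      (fun w e => measurable_viabilityDefect hf hG w₀ w hq hv hz hQ hQ' e)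
      (fun w x => (hcont x).curry_right)
      (fun x e => (hcont x).curry_left.comp continuous_subtype_val) hconv hex'
  simp only [viabilityDefect_le_zero_iff hVcl hV] at hsel
  refine ⟨fun x => (e x).1, measurable_fst.comp he, fun x => ?_⟩
  obtain ⟨hV, hrange, -⟩ := hsel ⟨w₀, hw₀⟩ x
  obtain ⟨u, -, hu⟩ := hex x
  exact ⟨hV, hu.of_inward hw₀ ⟨_, hrange⟩ fun w hw => (hsel ⟨w, hw⟩ x).2.2⟩

end Selection

section Bounds

variable {q : ℝ → Vec nx} {Q : ℝ → Mat nx nx} {K : Set ℝ} {V : Set (Vec nu)} {W : Set (Vec nw)}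

lemma contDiff_rhs (hf : ContDiff ℝ 1 fun a : Vec nx × Vec nw => f a.1 a.2)
    (hG : ∀ i j, ContDiff ℝ 1 fun x => G x i j) :
    ContDiff ℝ 1 fun a : Vec nx × Vec nu × Vec nw => rhs f G a.1 a.2.1 a.2.2 := by
  have hact : ContDiff ℝ 1 fun a : Vec nx × Vec nu × Vec nw => act (G a.1) a.2.1 := by
    refine contDiff_euclidean.2 fun i => ?_
    simp only [act_apply]
    exact ContDiff.sum fun j _ => ((hG i j).comp contDiff_fst).mul
      ((contDiff_euclidean.1 contDiff_id j).comp contDiff_snd.fst)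
  exact (hf.comp (contDiff_fst.prodMk contDiff_snd.snd)).add hact

lemma exists_norm_rhs_le_and_lipschitz (hf : ContDiff ℝ 1 fun a : Vec nx × Vec nw => f a.1 a.2)
    (hG : ∀ i j, ContDiff ℝ 1 fun x => G x i j) (r : ℝ) (hV : IsCompact V) (hW : IsCompact W) :
    ∃ B L : ℝ, 0 ≤ B ∧ 0 ≤ L ∧ ∀ u ∈ V, ∀ w ∈ W, ∀ x : Vec nx, ‖x‖ ≤ r →
      ‖rhs f G x u w‖ ≤ B ∧
      ∀ y : Vec nx, ‖y‖ ≤ r → ‖rhs f G x u w - rhs f G y u w‖ ≤ L * ‖x - y‖ := by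
  have hc := contDiff_rhs hf hG
  have hK : IsCompact (Metric.closedBall (0 : Vec nx) r ×ˢ V ×ˢ W) :=
    (isCompact_closedBall _ _).prod (hV.prod hW)
  obtain ⟨B, hB⟩ := hK.exists_bound_of_continuousOn hc.continuous.continuousOn
  obtain ⟨L, hL⟩ := hc.locallyLipschitz.locallyLipschitzOn.exists_lipschitzOnWith_of_compact hK
  refine ⟨max B 0, L, le_max_right _ _, L.2, fun u hu w hw x hx => ⟨?_, fun y hy => ?_⟩⟩
  · exact (hB (x, u, w) ⟨by simpa using hx, hu, hw⟩).trans (le_max_left _ _)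
  · have := hL.dist_le_mul (x, u, w) ⟨by simpa using hx, hu, hw⟩ (y, u, w)
      ⟨by simpa using hy, hu, hw⟩
    simpa [dist_eq_norm, Prod.norm_def] using this

lemma continuousOn_quad (hQ : ∀ i j, ContinuousOn (fun t => Q t i j) K) :
    ContinuousOn (fun a : ℝ × Vec nx => quad (Q a.1) a.2) (K ×ˢ univ) := by
  simp only [quad_eq_sum]
  refine continuousOn_finsetSum _ fun i _ => continuousOn_finsetSum _ fun j _ => ?_
  exact ((hQ i j).comp continuousOn_fst fun _ h => h.1).mul (by fun_prop)

lemma exists_norm_le_of_mem_ellipsoid (hK : IsCompact K) (hq : ContinuousOn q K)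
    (hQ : ∀ i j, ContinuousOn (fun t => Q t i j) K) (hpsd : ∀ t ∈ K, (Q t).PosSemidef) :
    ∃ r : ℝ, ∀ t ∈ K, ∀ p ∈ ellipsoid (q t) (Q t), ‖p‖ ≤ r := by
  obtain ⟨C, hC⟩ := hK.exists_bound_of_continuousOn hq
  obtain ⟨C', hC'⟩ := (hK.prod (isCompact_closedBall (0 : Vec nx) 1)).exists_bound_of_continuousOn
    ((continuousOn_quad hQ).mono (prod_mono_right (subset_univ _)))
  refine ⟨C + √C', ?_⟩
  rintro t ht _ ⟨v, hv, rfl⟩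
  refine (norm_add_le _ _).trans (add_le_add (hC t ht) ?_)
  rw [← supp_eq_norm (hpsd t ht)]
  exact Real.sqrt_le_sqrt ((le_abs_self _).trans (hC' (t, v) ⟨ht, by simpa using hv⟩))

end Bounds

section ViableTube

variable {V : Set (Vec nu)} {W : Set (Vec nw)} {q : ℝ → Vec nx} {Q : ℝ → Mat nx nx}

/-- At time `t` every point `q + Q z` of the tube `E(q, Q)` has a viable control in `V`. -/
def IsViableTubeAt (f : Vec nx → Vec nw → Vec nx) (G : Vec nx → Mat nx nu) (V : Set (Vec nu))
    (W : Set (Vec nw)) (q : ℝ → Vec nx) (Q : ℝ → Mat nx nx) (t : ℝ) : Prop :=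
  ∀ z, supp (Q t) z ≤ 1 →
    ∃ u ∈ V, IsViableControl f G W (q t) (Q t) (matDeriv Q t) (deriv q t) z u

/-- The control `u` is viable at the point `q + Q z` of the tube nearest to `ξ`. It is in this sense
that a feedback law is extended from the tube to the whole state space. -/
def IsViableAtNearest (f : Vec nx → Vec nw → Vec nx) (G : Vec nx → Mat nx nu) (W : Set (Vec nw))
    (q : ℝ → Vec nx) (Q : ℝ → Mat nx nx) (t : ℝ) (ξ : Vec nx) (u : Vec nu) : Prop :=
  ∃ z, supp (Q t) z ≤ 1 ∧
    Metric.infDist ξ (ellipsoid (q t) (Q t)) = dist ξ (q t + act (Q t) z) ∧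
    IsViableControl f G W (q t) (Q t) (matDeriv Q t) (deriv q t) z u

lemma measurable_matDeriv {m n : ℕ} (Q : ℝ → Mat m n) (i : Fin m) (j : Fin n) :
    Measurable fun t => matDeriv Q t i j :=
  measurable_deriv fun t => Q t i j

lemma exists_measurable_extend_prod {X Y Z : Type*} [MeasurableSpace X] [MeasurableSpace Y]
    [MeasurableSpace Z] {T : Set X} {V : Set Z} (hT : MeasurableSet T) (hV : V.Nonempty)
    {μ : T × Y → Z} (hμ : Measurable μ) (hμV : ∀ a, μ a ∈ V) :
    ∃ ν : X × Y → Z, Measurable ν ∧ (∀ a, ν a ∈ V) ∧ ∀ (t : T) y, ν (t, y) = μ (t, y) := by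
  have hemb : MeasurableEmbedding (Prod.map ((↑) : T → X) (id : Y → Y)) :=
    (MeasurableEmbedding.subtype_coe hT).prodMap .id
  obtain ⟨ν, hν, hext⟩ := hemb.exists_measurable_extend (g := fun a => (⟨μ a, hμV a⟩ : V))
    hμ.subtype_mk fun _ => hV.to_subtype
  exact ⟨fun a => ν a, measurable_subtype_coe.comp hν, fun a => (ν a).2,
    fun t y => congrArg Subtype.val (congrFun hext (t, y))⟩

lemma exists_measurable_isViableAtNearest {T : Set ℝ}
    (hf : Continuous fun a : Vec nx × Vec nw => f a.1 a.2)
    (hG : ∀ i j, Continuous fun x => G x i j) (hVconv : Convex ℝ V) (hVcl : IsClosed V)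
    (hV : V.Nonempty) (hW : W.Nonempty) (hT : MeasurableSet T) (hq : ContinuousOn q T)
    (hQ : ∀ i j, ContinuousOn (fun t => Q t i j) T) (hpsd : ∀ t ∈ T, (Q t).PosSemidef)
    (hviable : ∀ t ∈ T, IsViableTubeAt f G V W q Q t) :
    ∃ μ : ℝ → Vec nx → Vec nu, Measurable (Function.uncurry μ) ∧ (∀ t ξ, μ t ξ ∈ V) ∧
      ∀ t ∈ T, ∀ ξ, IsViableAtNearest f G W q Q t ξ (μ t ξ) := by
  have htime : Measurable fun a : T × Vec nx => (a.1 : ℝ) :=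
    measurable_subtype_coe.comp measurable_fst
  have hqm : Measurable fun a : T × Vec nx => q a.1 := hq.domRestrict.measurable.comp measurable_fst
  have hQm : ∀ i j, Measurable fun a : T × Vec nx => Q a.1 i j := fun i j =>
    (hQ i j).domRestrict.measurable.comp measurable_fst
  have hq' : Measurable fun a : T × Vec nx => deriv q a.1 := (measurable_deriv q).comp htime
  have hQ' : ∀ i j, Measurable fun a : T × Vec nx => matDeriv Q a.1 i j := fun i j =>
    (measurable_matDeriv Q i j).comp htime
  obtain ⟨z, hz, hnear⟩ := exists_measurable_nearest measurable_snd hqm hQm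
    fun a => hpsd a.1 a.1.2
  obtain ⟨μ, hμ, hμV⟩ := exists_measurable_viableControl hf hG hVconv hVcl hV hW hqm hq' hz hQm hQ'
    fun a => hviable a.1 a.1.2 (z a) (hnear a).1
  obtain ⟨ν, hν, hνV, hνμ⟩ := exists_measurable_extend_prod hT hV hμ fun a => (hμV a).1
  refine ⟨fun t ξ => ν (t, ξ), hν, fun t ξ => hνV (t, ξ), fun t ht ξ =>
    ⟨z (⟨t, ht⟩, ξ), (hnear (⟨t, ht⟩, ξ)).1, (hnear (⟨t, ht⟩, ξ)).2, ?_⟩⟩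
  have hcontrol : ν (t, ξ) = μ (⟨t, ht⟩, ξ) := hνμ ⟨t, ht⟩ ξ
  simpa only [hcontrol] using (hμV (⟨t, ht⟩, ξ)).2

lemma isFeedback_of_isCompact {μ : ℝ → Vec nx → Vec nu} (hV : IsCompact V)
    (hμ : Measurable (Function.uncurry μ)) (hμV : ∀ t ξ, μ t ξ ∈ V) (t₁ t₂ : ℝ) :
    IsFeedback V t₁ t₂ μ := by
  obtain ⟨C, hC⟩ := hV.isBounded.exists_norm_le
  exact ⟨hμ, fun ξ => Measure.integrableOn_of_bounded (M := C) (by simp)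
    (hμ.comp (measurable_id.prodMk measurable_const)).aestronglyMeasurable
    (Filter.Eventually.of_forall fun t => hC _ (hμV t ξ)), fun t _ ξ => hμV t ξ⟩

lemma exists_isFeedback_isViableAtNearest {t₁ t₂ : ℝ}
    (hf : Continuous fun a : Vec nx × Vec nw => f a.1 a.2)
    (hG : ∀ i j, Continuous fun x => G x i j) (hVconv : Convex ℝ V) (hVcpt : IsCompact V)
    (hV : V.Nonempty) (hW : W.Nonempty) (hq : ContinuousOn q (Icc t₁ t₂))
    (hQ : ∀ i j, ContinuousOn (fun t => Q t i j) (Icc t₁ t₂))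
    (hpsd : ∀ t ∈ Icc t₁ t₂, (Q t).PosSemidef)
    (hviable : ∀ᵐ t, t ∈ Ioo t₁ t₂ → IsViableTubeAt f G V W q Q t) :
    ∃ μ : ℝ → Vec nx → Vec nu, IsFeedback V t₁ t₂ μ ∧
      ∀ᵐ t, t ∈ Ioo t₁ t₂ → ∀ ξ, IsViableAtNearest f G W q Q t ξ (μ t ξ) := by
  obtain ⟨T, hTae, hT, hTviable⟩ := hviable.exists_measurable_mem
  have hsub : T ∩ Ioo t₁ t₂ ⊆ Icc t₁ t₂ := inter_subset_right.trans Ioo_subset_Icc_self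
  obtain ⟨μ, hμ, hμV, hnear⟩ := exists_measurable_isViableAtNearest hf hG hVconv hVcpt.isClosed hV
    hW (hT.inter measurableSet_Ioo) (hq.mono hsub) (fun i j => (hQ i j).mono hsub)
    (fun t ht => hpsd t (hsub ht)) fun t ht => hTviable t ht.1 ht.2
  refine ⟨μ, isFeedback_of_isCompact hVcpt hμ hμV t₁ t₂, ?_⟩
  filter_upwards [hTae] with t ht hmem using hnear t ⟨ht, hmem⟩

lemma mem_ellipsoid_of_isClosedLoopSolution {μ : ℝ → Vec nx → Vec nu} {w : ℝ → Vec nw}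
    {x : ℝ → Vec nx} {s s' C : ℝ} (hss' : s ≤ s')
    (hf : ContDiff ℝ 1 fun a : Vec nx × Vec nw => f a.1 a.2)
    (hG : ∀ i j, ContDiff ℝ 1 fun x => G x i j) (hV : IsCompact V) (hW : IsCompact W)
    (hq : AbsolutelyContinuousOnInterval q s s')
    (hQ : ∀ i j, AbsolutelyContinuousOnInterval (fun t => Q t i j) s s')
    (hpsd : ∀ t ∈ Icc s s', (Q t).PosSemidef)
    (hC : ∀ᵐ t, t ∈ Ioo s s' → ‖deriv q t‖ ≤ C)
    (hviable : ∀ᵐ t, t ∈ Ioo s s' → IsViableTubeAt f G V W q Q t)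
    (hμV : ∀ t ∈ Icc s s', ∀ ξ, μ t ξ ∈ V)
    (hμ : ∀ᵐ t, t ∈ Ioo s s' → ∀ ξ, IsViableAtNearest f G W q Q t ξ (μ t ξ))
    (hw : ∀ t ∈ Icc s s', w t ∈ W) (hx : IsClosedLoopSolution f G μ w s s' x)
    (hs : x s ∈ ellipsoid (q s) (Q s)) : x s' ∈ ellipsoid (q s') (Q s') := by
  have hcont : ∀ {E : Type} [NormedAddCommGroup E] {φ : ℝ → E},
      AbsolutelyContinuousOnInterval φ s s' → ContinuousOn φ (Icc s s') := fun hφ =>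
    uIcc_of_le hss' ▸ hφ.continuousOn
  obtain ⟨r₁, hr₁⟩ := exists_norm_le_of_mem_ellipsoid isCompact_Icc (hcont hq)
    (fun i j => hcont (hQ i j)) hpsd
  obtain ⟨r₂, hr₂⟩ := isCompact_Icc.exists_bound_of_continuousOn (hcont hx.1)
  obtain ⟨B, L, hB, hL, hrhs⟩ := exists_norm_rhs_le_and_lipschitz hf hG (max r₁ r₂) hV hW
  have htube : ∀ t ∈ Icc s s', ∀ z, supp (Q t) z ≤ 1 → ‖q t + act (Q t) z‖ ≤ max r₁ r₂ :=
    fun t ht z hz => le_max_of_le_left <|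
      hr₁ t ht _ ((mem_ellipsoid_iff (hpsd t ht)).2 ⟨z, hz, rfl⟩)
  have hxr : ∀ t ∈ Icc s s', ‖x t‖ ≤ max r₁ r₂ := fun t ht => le_max_of_le_right (hr₂ t ht)
  refine mem_ellipsoid_of_isTangent (B := B + |C|) hss' (by positivity) hL hx.1 hq hQ hpsd
    ?_ ?_ ?_ hs
  · filter_upwards [hx.2, hC] with t hxt hC hmem
    have ht := Ioo_subset_Icc_self hmem
    rw [(hxt ht).deriv]
    exact norm_sub_le_of_le (hrhs _ (hμV t ht _) _ (hw t ht) _ (hxr t ht)).1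
      ((hC hmem).trans (le_abs_self C))
  · filter_upwards [hviable, hC] with t hviable hC hmem z hz
    have ht := Ioo_subset_Icc_self hmem
    obtain ⟨u, hu, hzu⟩ := hviable hmem z hz.le
    exact ⟨_, norm_sub_le_of_le (hrhs u hu _ (hw t ht) _ (htube t ht z hz.le)).1
      ((hC hmem).trans (le_abs_self C)), hzu _ (hw t ht)⟩
  · filter_upwards [hμ, hx.2] with t hμ hxt hmem
    have ht := Ioo_subset_Icc_self hmem
    obtain ⟨z, hz, hdist, hzu⟩ := hμ hmem (x t)
    refine ⟨z, _, hz, hdist, hzu _ (hw t ht), ?_⟩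
    rw [(hxt ht).deriv, add_sub_cancel, hdist, dist_eq_norm]
    exact (hrhs _ (hμV t ht _) _ (hw t ht) _ (hxr t ht)).2 _ (htube t ht z hz)

lemma isRFIT_of_isViableTubeAt {t₁ t₂ C : ℝ}
    (hf : ContDiff ℝ 1 fun a : Vec nx × Vec nw => f a.1 a.2)
    (hG : ∀ i j, ContDiff ℝ 1 fun x => G x i j) (hVconv : Convex ℝ V) (hVcpt : IsCompact V)
    (hV : V.Nonempty) (hWcpt : IsCompact W) (hW : W.Nonempty)
    (hq : AbsolutelyContinuousOnInterval q t₁ t₂)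
    (hQ : ∀ i j, AbsolutelyContinuousOnInterval (fun t => Q t i j) t₁ t₂)
    (hpsd : ∀ t ∈ Icc t₁ t₂, (Q t).PosSemidef)
    (hC : ∀ᵐ t, t ∈ Ioo t₁ t₂ → ‖deriv q t‖ ≤ C)
    (hviable : ∀ᵐ t, t ∈ Ioo t₁ t₂ → IsViableTubeAt f G V W q Q t) :
    IsRFIT f G V W t₁ t₂ fun t => ellipsoid (q t) (Q t) := by
  obtain ⟨μ, hfb, hμ⟩ := exists_isFeedback_isViableAtNearest hf.continuous
    (fun i j => (hG i j).continuous) hVconv hVcpt hV hW (hq.continuousOn.mono Icc_subset_uIcc)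
    (fun i j => (hQ i j).continuousOn.mono Icc_subset_uIcc) hpsd hviable
  refine ⟨μ, hfb, fun w hw s hs s' hs' hss' x hx hxs => ?_⟩
  have hIcc : Icc s s' ⊆ Icc t₁ t₂ := Icc_subset_Icc hs.1 hs'.2
  have hIoo : Ioo s s' ⊆ Ioo t₁ t₂ := Ioo_subset_Ioo hs.1 hs'.2
  have huIcc : uIcc s s' ⊆ uIcc t₁ t₂ :=
    uIcc_subset_uIcc (Icc_subset_uIcc hs) (Icc_subset_uIcc hs')
  exact mem_ellipsoid_of_isClosedLoopSolution hss' hf hG hVcpt hWcpt (hq.mono huIcc)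
    (fun i j => (hQ i j).mono huIcc) (fun t ht => hpsd t (hIcc ht))
    (hC.mono fun t h ht => h (hIoo ht)) (hviable.mono fun t h ht => h (hIoo ht))
    (fun t ht => hfb.2.2 t (hIcc ht)) (hμ.mono fun t h ht => h (hIoo ht))
    (fun t ht => hw.2 t (hIcc ht)) hx hxs

lemma IsRFIT.mono {V' : Set (Vec nu)} {W' : Set (Vec nw)} {t₁ t₂ : ℝ} {Y : ℝ → Set (Vec nx)}
    (h : IsRFIT f G V W t₁ t₂ Y) (hV : V ⊆ V') (hW : W' ⊆ W) : IsRFIT f G V' W' t₁ t₂ Y := by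
  obtain ⟨μ, hμ, hinv⟩ := h
  exact ⟨μ, ⟨hμ.1, hμ.2.1, fun t ht ξ => hV (hμ.2.2 t ht ξ)⟩,
    fun w hw => hinv w ⟨hw.1, fun t ht => hW (hw.2 t ht)⟩⟩

end ViableTube

end Feedback

end

end EllTube

open EllTube in
theorem theorem3_general {nx nu nw : ℕ} {f : Vec nx → Vec nw → Vec nx} {G : Vec nx → Mat nx nu}
    (hf : ContDiff ℝ 1 fun a : Vec nx × Vec nw => f a.1 a.2)
    (hG : ∀ i j, ContDiff ℝ 1 fun x => G x i j)
    {V : Set (Vec nu)} (hVconv : Convex ℝ V) (hVcpt : IsCompact V) {t₁ t₂ : ℝ} (ht : t₁ ≤ t₂)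
    {qw : Vec nw} {Qw : Mat nw nw} (hQw : Qw.PosSemidef)
    {ux ubar : ℝ → Vec nu} (hux : ∀ t ∈ Icc t₁ t₂, ux t ∈ V)
    {Ru : ℝ → Mat nu nu} (hRu : ∀ t ∈ Icc t₁ t₂, ellipsoid (ubar t) (Ru t) ⊆ V)
    {qx : ℝ → Vec nx} (hqx : AbsolutelyContinuousOnInterval qx t₁ t₂)
    {Qx : ℝ → Mat nx nx} (hQx : ∀ i j, AbsolutelyContinuousOnInterval (fun t => Qx t i j) t₁ t₂)
    (hQx' : ∀ t ∈ Icc t₁ t₂, (Qx t).PosSemidef)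
    {Ωn : Vec nx → Mat nx nx → Mat nx nx} (hΩn : ∀ t ∈ Icc t₁ t₂, (Ωn (qx t) (Qx t)).PosSemidef)
    (hn : ∀ t ∈ Icc t₁ t₂, ∀ ξ ∈ ellipsoid 0 (Qx t), ∀ ω ∈ ellipsoid 0 Qw,
      remainder f G qw (qx t) (ux t) (ubar t) ξ ω 0 ∈ ellipsoid 0 (Ωn (qx t) (Qx t)))
    {S : ℝ → Mat nx nu} (hS : ∀ t ∈ Icc t₁ t₂, Loewner (S t * (S t)ᵀ) 1)
    {ΩG : Vec nx → Mat nx nx → Mat nu nu → Mat nx nu → Mat nx nx}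
    (hΩG : ∀ t ∈ Icc t₁ t₂, ∀ p ∈ ellipsoid (qx t) (Qx t),
      Loewner (controlTerm (Qx t) (S t) (Ru t) (G p) - controlTerm (Qx t) (S t) (Ru t) (G (qx t)))
        (ΩG (qx t) (Qx t) (Ru t) (S t)))
    {lam kap : ℝ → ℝ} (hlam : ∀ t ∈ Icc t₁ t₂, 0 < lam t) (hkap : ∀ t ∈ Icc t₁ t₂, 0 < kap t)
    (hode : ∀ᵐ t : ℝ, t ∈ Icc t₁ t₂ → HasDerivAt qx (rhs f G (qx t) (ux t) qw) t)
    (hineq : ∀ᵐ t : ℝ, t ∈ Icc t₁ t₂ →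
      Loewner (Phi f G qw Qw Ωn ΩG (ux t) (qx t) (Qx t) (S t) (Ru t) (lam t) (kap t))
        (matDeriv Qx t)) :
    IsRFIT f G V (ellipsoid qw Qw) t₁ t₂ fun t => ellipsoid (qx t) (Qx t) := by
  have hqw := center_mem_ellipsoid qw Qw
  have hWcpt := isCompact_ellipsoid qw Qw
  obtain ⟨r, hr⟩ := exists_norm_le_of_mem_ellipsoid isCompact_Icc
    (hqx.continuousOn.mono Icc_subset_uIcc)
    (fun i j => (hQx i j).continuousOn.mono Icc_subset_uIcc) hQx'
  obtain ⟨C, _, -, -, hC⟩ := exists_norm_rhs_le_and_lipschitz hf hG r hVcpt hWcpt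
  refine isRFIT_of_isViableTubeAt (C := C) hf hG hVconv hVcpt ⟨_, hux t₁ ⟨le_rfl, ht⟩⟩ hWcpt
    ⟨qw, hqw⟩ hqx hQx hQx' ?_ ?_
  · filter_upwards [hode] with t hode hmem
    have ht := Ioo_subset_Icc_self hmem
    rw [(hode ht).deriv]
    exact (hC _ (hux t ht) _ hqw _ (hr t ht _ (center_mem_ellipsoid _ _))).1
  · filter_upwards [hode, hineq, ae_quad_matDeriv_eq_zero hQx hQx'] with t hode hineq hker hmem z hz
    have ht := Ioo_subset_Icc_self hmem
    refine ⟨ubar t + act (gain (Qx t) (S t) (Ru t)) z,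
      hRu t ht (add_act_gain_mem_ellipsoid (hQx' t ht) (hS t ht) (Ru t) (ubar t) hz), ?_⟩
    rw [(hode ht).deriv]
    exact isViableControl_gain (hQx' t ht) hQw (hΩn t ht) (hn t ht) (hΩG t ht) (hlam t ht)
      (hkap t ht) (hineq ht) (hker hmem) hz

theorem theorem3 {nx nu nw : ℕ}
    (f : EllTube.Vec nx → EllTube.Vec nw → EllTube.Vec nx)
    (G : EllTube.Vec nx → EllTube.Mat nx nu)
    (U : Set (EllTube.Vec nu)) (W : Set (EllTube.Vec nw))
    (t₁ t₂ : ℝ) (ht : t₁ ≤ t₂)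
    -- ellipsoidal bounds on the disturbance and control sets
    (qw : EllTube.Vec nw) (Qw : EllTube.Mat nw nw) (hQw : Qw.PosSemidef)
    (hW : W ⊆ EllTube.ellipsoid qw Qw)
    (qu : EllTube.Vec nu) (Qu : EllTube.Mat nu nu) (hQu : Qu.PosSemidef)
    (hU : EllTube.ellipsoid qu Qu ⊆ U)
    -- `f` and `G` are twice continuously differentiable
    (hf : ContDiff ℝ 2 (fun z : EllTube.Vec nx × EllTube.Vec nw => f z.1 z.2))
    (hG : ∀ i j, ContDiff ℝ 2 (fun x => G x i j))
    -- the reference control and the inner ellipsoids `E(u_x(t), R_u(t))`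
    (ux : ℝ → EllTube.Vec nu) (hux : EllTube.IsSignal t₁ t₂ U ux)
    (hux' : ∀ t ∈ Set.Icc t₁ t₂, ux t ∈ EllTube.ellipsoid qu Qu)
    (γ : ℝ → ℝ) (hγ : ∀ t ∈ Set.Icc t₁ t₂, 0 < γ t ∧ γ t ≤ 1)
    (Ru : ℝ → EllTube.Mat nu nu) (hRu : ∀ t ∈ Set.Icc t₁ t₂, (Ru t).PosSemidef)
    (hRu' : ∀ t ∈ Set.Icc t₁ t₂, Ru t = EllTube.innerShape qu Qu (γ t) (ux t))
    -- center and shape matrix of the tube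
    (qx : ℝ → EllTube.Vec nx) (hqx : AbsolutelyContinuousOnInterval qx t₁ t₂)
    (Qx : ℝ → EllTube.Mat nx nx)
    (hQx : ∀ i j, AbsolutelyContinuousOnInterval (fun t => Qx t i j) t₁ t₂)
    (hQx' : ∀ t ∈ Set.Icc t₁ t₂, (Qx t).PosSemidef)
    -- nonlinearity bounders; control perturbations are measured from `u_x(t)` or from `q_u`
    (ubar : ℝ → EllTube.Vec nu) (hubar : ubar = ux ∨ ubar = fun _ => qu)
    (Ωn : EllTube.Vec nx → EllTube.Mat nx nx → EllTube.Mat nx nx)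
    (hΩn : EllTube.IsRemainderBounder f G qw Qw Qu t₁ t₂ ux ubar qx Qx Ωn)
    (ΩG : EllTube.Vec nx → EllTube.Mat nx nx → EllTube.Mat nu nu → EllTube.Mat nx nu →
      EllTube.Mat nx nx)
    (hΩG : EllTube.IsInputBounder G t₁ t₂ qx Qx Ru ΩG)
    -- the scaling functions and the contraction-valued function `S`
    (lam kap : ℝ → ℝ) (hlam : ∀ t ∈ Set.Icc t₁ t₂, 0 < lam t)
    (hkap : ∀ t ∈ Set.Icc t₁ t₂, 0 < kap t)
    (S : ℝ → EllTube.Mat nx nu)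
    (hS : ∀ t ∈ Set.Icc t₁ t₂, EllTube.Loewner (S t * (S t)ᵀ) 1)
    -- the nominal ODE and the matrix differential inequality
    (hode : ∀ᵐ t : ℝ, t ∈ Set.Icc t₁ t₂ →
      HasDerivAt qx (EllTube.rhs f G (qx t) (ux t) qw) t)
    (hineq : ∀ᵐ t : ℝ, t ∈ Set.Icc t₁ t₂ →
      EllTube.Loewner
        (EllTube.Phi f G qw Qw Ωn ΩG (ux t) (qx t) (Qx t) (S t) (Ru t) (lam t) (kap t))
        (EllTube.matDeriv Qx t)) :
    EllTube.IsRFIT f G U W t₁ t₂ (fun t => EllTube.ellipsoid (qx t) (Qx t)) := by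
  have hRuU : ∀ t ∈ Icc t₁ t₂, EllTube.ellipsoid (ubar t) (Ru t) ⊆ EllTube.ellipsoid qu Qu := by
    intro t ht
    rw [hRu' t ht]
    exact EllTube.ellipsoid_innerShape_subset hQu (hγ t ht).1 (hγ t ht).2 (hux' t ht)
      (hRu' t ht ▸ hRu t ht) (hubar.imp (congrFun · t) (congrFun · t))
  exact (theorem3_general (hf.of_le one_le_two) (fun i j => (hG i j).of_le one_le_two)
    (EllTube.convex_ellipsoid qu Qu) (EllTube.isCompact_ellipsoid qu Qu) ht hQw hux' hRuU hqx hQx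
    hQx' (fun t ht => hΩn.1 _ _ (hQx' t ht))
    (fun t ht ξ hξ ω hω => hΩn.2 t ht ξ hξ ω hω 0 (EllTube.center_mem_ellipsoid 0 Qu)) hS
    (fun t ht p hp => hΩG.2 t ht p hp _ (hS t ht)) hlam hkap hode hineq).mono hU hW
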